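/- For $n\ge 2$ and $x\in\mathbb Z^n$ let $a$ be the vector of the coordinates of $x$ rearranged so that $|a_1|\ge|a_2|\ge\dots\ge|a_n|$, let $x_{-k}$ be $x$ without its $k$ coordinates of largest absolute value, so that $\|x_{-k}\|_2^2=\sum_{i=k+1}^n a_i^2$, and put $0^0=0$ in powers $|a_i|^p$ (the moment of order $0$ counts nonzero coordinates). Logarithms are to base $2$. A linear sketch is given by a uniformly random bit string (the seed), an integer matrix $S$ with $n$ columns that is determined by the seed and does not depend on the input $x$, and an estimator that computes the output from the seed and the vector $Sx$. For inputs with $\|x\|_\infty\le m$, it uses $b$ bits of space if the length of the seed plus the number of bits in which $Sx$ is stored, in signed words of a fixed length that suffices for every entry of $Sx$, every seed and every $x\in\mathbb Z^n$ with $\|x\|_\infty\le m$, is at most $b$. **Theorem.** For every constant $c\in\mathbb R$ there is an exponent $B>0$, and for all constants $d\in\mathbb N$ and $\delta\in(0,1)$ there is an $A>0$ (depending only on $c,d,\delta$), such that the following holds for all integers $n\ge 2$ and $0\le k\le n$ and all real $0\le p\le 2$ and $\varepsilon\in(0,1)$. There is a linear sketch that uses at most $A\,(\log n/\varepsilon)^{B}$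 bits of space for inputs with $\|x\|_\infty\le n^d$ and such that, for every $x\in\mathbb Z^n$ with $\|x\|_\infty\le n^d$ and $$a_k^2\ \ge\ (\varepsilon/\log n)^c\cdot\frac{\|x_{-k}\|_2^2}{k}$$ (no condition if $k=0$), its output $Z$ satisfies $$(1-\varepsilon)\sum_{i=1}^k|a_i|^p\ \le\ Z\ \le\ (1+\varepsilon)\sum_{i=1}^k|a_i|^p$$ with probability at least $1-\delta$ over the seed. -/

import Mathlib

open scoped Matrix

noncomputable section

/-- The coordinates of `x` rearranged in non-increasing order of absolute value
(indexed from `0`). -/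
def rearranged {n : ℕ} (x : Fin n → ℤ) : Fin n → ℤ :=
  x ∘ Tuple.sort (fun i => -|x i|)

/-- `rankedCoord x i` is `a_i`, the coordinate of `x` of the `i`-th largest absolute value,
for `1 ≤ i ≤ n` (indexed from `1`); it is `0` for every other `i`. -/
def rankedCoord {n : ℕ} (x : Fin n → ℤ) (i : ℕ) : ℝ :=
  if h : 1 ≤ i ∧ i ≤ n then (rearranged x ⟨i - 1, by omega⟩ : ℝ) else 0

/-- The squared Euclidean norm of `x_{-k}`, the vector `x` without its `k` coordinates that are
largest in absolute value. -/
def tailNormSq {n : ℕ} (x : Fin n → ℤ) (k : ℕ) : ℝ :=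
  ∑ i ∈ Finset.Icc (k + 1) n, rankedCoord x i ^ 2

/-- `|t| ^ p` with the convention `0 ^ 0 = 0` of frequency moments: the moment of order `0` counts
the nonzero frequencies. -/
def absPow (t p : ℝ) : ℝ :=
  if t = 0 then 0 else |t| ^ p

/-- The `F_p` moment of the `k` coordinates of `x` that are largest in absolute value. -/
def topMoment {n : ℕ} (x : Fin n → ℤ) (k : ℕ) (p : ℝ) : ℝ :=
  ∑ i ∈ Finset.Icc 1 k, absPow (rankedCoord x i) p

/-- A linear sketch of vectors in `ℤⁿ`, with its estimator. A uniformly random string of `seedLen`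
bits determines an integer matrix with `rows` rows, without reference to the input. What is kept
is the random string and the product of the matrix with the input, each entry of which is stored
as a sign bit and `wordLen` bits. The estimate is computed from what is kept. -/
structure LinearSketch (n : ℕ) where
  seedLen : ℕ
  rows : ℕ
  wordLen : ℕ
  mat : (Fin seedLen → Bool) → Matrix (Fin rows) (Fin n) ℤ
  estimate : (Fin seedLen → Bool) → (Fin rows → ℤ) → ℝ

namespace LinearSketch

variable {n : ℕ}

/-- The number of bits in which the random string and the sketched vector are stored. -/
def bits (S : LinearSketch n) : ℕ :=
  S.seedLen + S.rows * (S.wordLen + 1)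

/-- For every input whose coordinates are at most `m` in absolute value, and whatever the random
string is, the entries of the sketched vector fit into the words in which they are stored. -/
def Fits (S : LinearSketch n) (m : ℕ) : Prop :=
  ∀ ω : Fin S.seedLen → Bool, ∀ x : Fin n → ℤ, (∀ i, |x i| ≤ (m : ℤ)) →
    ∀ j, |(S.mat ω *ᵥ x) j| < (2 : ℤ) ^ S.wordLen

/-- The output of the sketch on input `x` when the random string is `ω`. -/
def output (S : LinearSketch n) (ω : Fin S.seedLen → Bool) (x : Fin n → ℤ) : ℝ :=
  S.estimate ω (S.mat ω *ᵥ x)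

/-- The probability, over the uniformly random string, that the output on input `x` is within a
factor `1 ± ε` of `v`. -/
def successProb (S : LinearSketch n) (x : Fin n → ℤ) (v ε : ℝ) : ℝ :=
  (Set.ncard {ω : Fin S.seedLen → Bool |
    (1 - ε) * v ≤ S.output ω x ∧ S.output ω x ≤ (1 + ε) * v} : ℝ) / 2 ^ S.seedLen

end LinearSketch

end

/-! The sketch stores the inner products of `x` with random rows over {-1, 0, 1}, whose entries are
nonzero with probability r = 1/2, 1/4, …. For such a row `ξ` the mean of cos(θ⟨ξ, x⟩) is the product
of the factors 1 - r(1 - cos(θ x_i)) (`sum_rowWeight_mul_cos`). Integrality makes everything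
2π-periodic in θ, so Hoeffding's inequality on a grid shows that few rows determine these means up
to a small additive error, uniformly in θ (`sum_not_agrees_le`). The estimator takes any vector `y`
that satisfies the promise and has matching means, and returns the top moment of `y`. It remains to
show that the means determine the top moment up to 1 ± ε; `topMoment_le_of_cosProd_close` gives one
direction, and the roles of `x` and `y` can be exchanged.

At a rate r that is small compared with 1/D, where D is the sum of 1 - cos(θ x_i), the product is
about 1 - rD. Choosing the rate to suit D therefore gives D with a small relative error
(`abs_cosDefect_sub_le`). A smooth approximation of the indicator of |v| ≥ 1 is a signed mixture of
functions 1 - cos(ωv) (`exists_smoothStep_eq_integral`), so the smoothed number of coordinates above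
every scale t is determined as well (`exists_abs_sum_smoothStep_sub_le`).

These counts give the moment by summation over levels: for every s, the top moment of `y` is at most
k s^p plus the sum over t > s of t^p - (t-1)^p times the count at t. With s = |a_k| of `x`, the same
expression for `x` exceeds the top moment of `x` only slightly: the smoothing moves thresholds by a
factor 1 + 1/J, and the promise bounds the contribution of the tail
(`HasThreshold.add_sum_smoothStep_le`). The error of the counts is controlled by a harmonic sum
(`HasThreshold.sum_powStep_mul_min_le`).

Fully random rows would need a long seed; `exists_forall_mul_card_le` selects a short list of row
systems that serves every bounded input. -/

/-! ### Smooth steps as mixtures of cosines -/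

open MeasureTheory FourierTransform in
/-- Fourier representation of the bump `σ (z + 1) - σ z`, where `σ` is the smooth transition. -/
theorem exists_fourier_bump : ∃ g : SchwartzMap ℝ ℂ, ∀ z : ℝ,
    ((Real.smoothTransition (z + 1) - Real.smoothTransition z : ℝ) : ℂ)
      = ∫ ξ : ℝ, Complex.exp ((2 * Real.pi * ξ * z : ℝ) * Complex.I) * g ξ := by
  set f : ℝ → ℂ := fun z =>
    ((Real.smoothTransition (z + 1) - Real.smoothTransition z : ℝ) : ℂ) with hf
  have hc : HasCompactSupport f := by
    refine HasCompactSupport.intro (K := Set.Icc (-1) 1) isCompact_Icc fun z hz => ?_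
    rw [Set.mem_Icc, not_and_or, not_le, not_le] at hz
    rcases hz with hz | hz
    · simp [hf, Real.smoothTransition.zero_of_nonpos (show z + 1 ≤ 0 by linarith),
        Real.smoothTransition.zero_of_nonpos (show z ≤ 0 by linarith)]
    · simp [hf, Real.smoothTransition.one_of_one_le (show 1 ≤ z + 1 by linarith),
        Real.smoothTransition.one_of_one_le (show 1 ≤ z by linarith)]
  have hs : ContDiff ℝ (⊤ : ℕ∞) f := by
    refine Complex.ofRealCLM.contDiff.comp (ContDiff.sub ?_ Real.smoothTransition.contDiff)
    exact Real.smoothTransition.contDiff.comp (contDiff_id.add contDiff_const)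
  set F : SchwartzMap ℝ ℂ := hc.toSchwartzMap hs with hF
  refine ⟨𝓕 F, fun z => ?_⟩
  have h : (𝓕⁻ (𝓕 F)) z = F z := by rw [fourierInv_fourier_eq]
  have h2 : F z = f z := rfl
  rw [← hf] at *
  change f z = _
  rw [← h2, ← h, SchwartzMap.fourierInv_coe, Real.fourierInv_eq']
  refine integral_congr_ae (Filter.Eventually.of_forall fun ξ => ?_)
  simp only [smul_eq_mul]
  congr 3
  simp [mul_comm, mul_assoc, mul_left_comm]

/-- The sum of `2 J + 1` integer translates of the bump. -/
noncomputable def plateau (J : ℕ) (z : ℝ) : ℝ :=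
  Real.smoothTransition (z + J + 1) - Real.smoothTransition (z - J)

/-- The sum telescopes. Translation changes a Fourier transform only by a phase, so the plateau has
a density at most 2J + 1 times that of one bump, which keeps the later bounds polynomial in J. -/
theorem plateau_eq_sum (J : ℕ) (z : ℝ) :
    plateau J z = ∑ i ∈ Finset.range (2 * J + 1),
      (Real.smoothTransition (z + J - i + 1) - Real.smoothTransition (z + J - i)) := by
  have := Finset.sum_range_sub' (fun i : ℕ => Real.smoothTransition (z + J - i + 1)) (2 * J + 1)
  rw [plateau, show z - (J : ℝ) = z + J - ((2 * J + 1 : ℕ) : ℝ) + 1 by push_cast; ring]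
  simp only [Nat.cast_zero, sub_zero] at this
  rw [← this]
  refine Finset.sum_congr rfl fun i _ => ?_
  congr 2
  push_cast
  ring

theorem plateau_nonneg (J : ℕ) (z : ℝ) : 0 ≤ plateau J z := by
  have : Real.smoothTransition (z - J) ≤ Real.smoothTransition (z + J + 1) :=
    Real.smoothTransition.monotone (by have : (0 : ℝ) ≤ J := J.cast_nonneg; linarith)
  rw [plateau]; linarith

theorem plateau_le_one (J : ℕ) (z : ℝ) : plateau J z ≤ 1 := by
  have := Real.smoothTransition.nonneg (z - J)
  have := Real.smoothTransition.le_one (z + J + 1)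
  rw [plateau]; linarith

theorem plateau_eq_one {J : ℕ} {z : ℝ} (h : |z| ≤ J) : plateau J z = 1 := by
  rw [abs_le] at h
  rw [plateau, Real.smoothTransition.one_of_one_le (by linarith),
    Real.smoothTransition.zero_of_nonpos (by linarith), sub_zero]

theorem plateau_eq_zero {J : ℕ} {z : ℝ} (h : (J : ℝ) + 1 ≤ |z|) : plateau J z = 0 := by
  have hJ : (0 : ℝ) ≤ J := J.cast_nonneg
  rcases le_abs.1 h with h | h
  · rw [plateau, Real.smoothTransition.one_of_one_le (by linarith),
      Real.smoothTransition.one_of_one_le (by linarith), sub_self]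
  · rw [plateau, Real.smoothTransition.zero_of_nonpos (by linarith),
      Real.smoothTransition.zero_of_nonpos (by linarith), sub_self]

/-- An even smooth step: `0` for `|v| ≤ J / (J + 1)` and `1` for `1 ≤ |v|`. -/
noncomputable def smoothStep (J : ℕ) (v : ℝ) : ℝ :=
  1 - (plateau J ((J + 1) * v) + plateau J (-((J + 1) * v))) / 2

theorem smoothStep_nonneg (J : ℕ) (v : ℝ) : 0 ≤ smoothStep J v := by
  have := plateau_le_one J ((J + 1) * v)
  have := plateau_le_one J (-((J + 1) * v))
  rw [smoothStep]; linarith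

theorem smoothStep_le_one (J : ℕ) (v : ℝ) : smoothStep J v ≤ 1 := by
  have := plateau_nonneg J ((J + 1) * v)
  have := plateau_nonneg J (-((J + 1) * v))
  rw [smoothStep]; linarith

theorem smoothStep_eq_zero {J : ℕ} {v : ℝ} (h : (J + 1) * |v| ≤ J) : smoothStep J v = 0 := by
  have h1 : |((J : ℝ) + 1) * v| ≤ J := by rwa [abs_mul, abs_of_nonneg (by positivity)]
  rw [smoothStep, plateau_eq_one h1, plateau_eq_one (by rwa [abs_neg])]
  norm_num

theorem smoothStep_eq_one {J : ℕ} {v : ℝ} (h : 1 ≤ |v|) : smoothStep J v = 1 := by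
  have h1 : (J : ℝ) + 1 ≤ |((J : ℝ) + 1) * v| := by
    rw [abs_mul, abs_of_nonneg (by positivity)]
    exact le_mul_of_one_le_right (by positivity) h
  rw [smoothStep, plateau_eq_zero h1, plateau_eq_zero (by rwa [abs_neg])]
  norm_num

open MeasureTheory in
/-- The smooth step is a mixture of the functions `1 - cos (ω v)` with a signed density `m`. The
corresponding mixture with density `|m|` is at most `C (J + 1) ^ 3 * min 1 (v ^ 2)`. -/
theorem exists_smoothStep_eq_integral : ∃ C : ℝ, 1 ≤ C ∧ ∀ J : ℕ, ∃ m : ℝ → ℝ, Integrable m ∧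
    (∀ v, smoothStep J v = ∫ ξ, (1 - Real.cos (2 * Real.pi * ξ * ((J + 1) * v))) * m ξ) ∧
    (∫ ξ, |m ξ|) ≤ C * (J + 1) ^ 3 ∧
    ∀ v, ∫ ξ, (1 - Real.cos (2 * Real.pi * ξ * ((J + 1) * v))) * |m ξ|
      ≤ C * (J + 1) ^ 3 * min 1 (v ^ 2) := by
  obtain ⟨g, hg⟩ := exists_fourier_bump
  set I0 := ∫ ξ, ‖g ξ‖ with hI0
  set I2 := ∫ ξ, ‖ξ‖ ^ 2 * ‖g ξ‖ with hI2
  have hi0 : Integrable (fun ξ => ‖g ξ‖) := g.integrable.norm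
  have hi2 : Integrable (fun ξ => ‖ξ‖ ^ 2 * ‖g ξ‖) := g.integrable_pow_mul volume 2
  have hI0n : 0 ≤ I0 := integral_nonneg fun _ => by positivity
  have hI2n : 0 ≤ I2 := integral_nonneg fun _ => by positivity
  -- The term with `I0` serves 1 - cos ≤ 2, the term with `I2` serves 1 - cos w ≤ w²/2, each against
  -- |m| ≤ 2(J + 1)‖g‖.
  refine ⟨1 + 4 * I0 + 4 * Real.pi ^ 2 * I2, by nlinarith [sq_nonneg Real.pi], fun J => ?_⟩
  set N : ℝ := (J : ℝ) + 1 with hN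
  have hN1 : 1 ≤ N := by simp [hN]
  set u : ℝ → ℂ := fun ξ => ∑ i ∈ Finset.range (2 * J + 1),
    Complex.exp ((2 * Real.pi * ξ * ((J : ℝ) - i) : ℝ) * Complex.I) with hu
  have hucont : Continuous u := by fun_prop
  have hunorm : ∀ ξ, ‖u ξ‖ ≤ 2 * N := fun ξ => by
    refine (norm_sum_le _ _).trans ?_
    simp only [Complex.norm_exp_ofReal_mul_I, Finset.sum_const, Finset.card_range, nsmul_eq_mul,
      mul_one]
    push_cast
    linarith
  have hug : Integrable (fun ξ => u ξ * g ξ) :=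
    g.integrable.bdd_mul hucont.aestronglyMeasurable (Filter.Eventually.of_forall hunorm)
  have hexp : ∀ z : ℝ, Integrable
      (fun ξ => Complex.exp ((2 * Real.pi * ξ * z : ℝ) * Complex.I) * (u ξ * g ξ)) := fun z =>
    hug.bdd_mul (c := 1) (by fun_prop)
      (Filter.Eventually.of_forall fun ξ => by rw [Complex.norm_exp_ofReal_mul_I])
  have hplat : ∀ z : ℝ, (plateau J z : ℂ)
      = ∫ ξ : ℝ, Complex.exp ((2 * Real.pi * ξ * z : ℝ) * Complex.I) * (u ξ * g ξ) := fun z => by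
    rw [plateau_eq_sum, Complex.ofReal_sum,
      Finset.sum_congr rfl fun (i : ℕ) (_ : i ∈ Finset.range (2 * J + 1)) => hg (z + J - (i : ℝ)),
      ← integral_finsetSum]
    · refine integral_congr_ae (Filter.Eventually.of_forall fun ξ => ?_)
      simp only [hu, Finset.sum_mul, Finset.mul_sum]
      refine Finset.sum_congr rfl fun i _ => ?_
      rw [← mul_assoc, ← Complex.exp_add]
      congr 2
      push_cast
      ring
    · intro i _
      exact g.integrable.bdd_mul (c := 1) (by fun_prop)
        (Filter.Eventually.of_forall fun ξ => by rw [Complex.norm_exp_ofReal_mul_I])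
  set m : ℝ → ℝ := fun ξ => (u ξ * g ξ).re with hm
  have hmi : Integrable m := hug.re
  have hmle : ∀ ξ, |m ξ| ≤ 2 * N * ‖g ξ‖ := fun ξ =>
    (Complex.abs_re_le_norm _).trans (by rw [norm_mul]; gcongr; exact hunorm ξ)
  have hcosi : ∀ z : ℝ, Integrable (fun ξ => Real.cos (2 * Real.pi * ξ * z) * m ξ) := fun z =>
    hmi.bdd_mul (c := 1) (by fun_prop)
      (Filter.Eventually.of_forall fun ξ => by simpa using Real.abs_cos_le_one _)
  have hdefi : ∀ z : ℝ, Integrable (fun ξ => (1 - Real.cos (2 * Real.pi * ξ * z)) * |m ξ|) :=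
    fun z => hmi.abs.bdd_mul (c := 2) (by fun_prop) (Filter.Eventually.of_forall fun ξ => by
      have := Real.abs_cos_le_one (2 * Real.pi * ξ * z)
      rw [abs_le] at this
      rw [Real.norm_eq_abs, abs_le]
      constructor <;> linarith)
  have heven : ∀ z : ℝ, (plateau J z + plateau J (-z)) / 2
      = ∫ ξ, Real.cos (2 * Real.pi * ξ * z) * m ξ := fun z => by
    have h : ((plateau J z + plateau J (-z) : ℝ) : ℂ)
        = ∫ ξ : ℝ, (2 * Real.cos (2 * Real.pi * ξ * z) : ℂ) * (u ξ * g ξ) := by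
      rw [Complex.ofReal_add, hplat z, hplat (-z), ← integral_add (hexp z) (hexp (-z))]
      refine integral_congr_ae (Filter.Eventually.of_forall fun ξ => ?_)
      simp only
      rw [← add_mul, Complex.ofReal_cos, Complex.two_cos]
      congr 3
      push_cast
      ring_nf
    have h2 := congrArg Complex.re h
    have hint : Integrable (fun ξ => (2 * Real.cos (2 * Real.pi * ξ * z) : ℂ) * (u ξ * g ξ)) :=
      hug.bdd_mul (c := 2) (by fun_prop) (Filter.Eventually.of_forall fun ξ => by
        rw [norm_mul, Complex.norm_real, Complex.norm_ofNat]
        have := Real.abs_cos_le_one (2 * Real.pi * ξ * z)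
        rw [Real.norm_eq_abs]
        linarith)
    rw [Complex.ofReal_re] at h2
    rw [h2, ← RCLike.re_eq_complex_re, ← integral_re hint, ← integral_div]
    refine integral_congr_ae (Filter.Eventually.of_forall fun ξ => ?_)
    simp only [hm, RCLike.re_eq_complex_re]
    rw [show (2 * (Real.cos (2 * Real.pi * ξ * z) : ℂ))
      = ((2 * Real.cos (2 * Real.pi * ξ * z) : ℝ) : ℂ) by push_cast; rfl, Complex.re_ofReal_mul]
    ring
  refine ⟨m, hmi, fun v => ?_, ?_, fun v => ?_⟩
  -- The plateau is 1 at the origin, so the density has total mass 1 and the constant in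
  -- `smoothStep` can be moved under the integral.
  · have h0 := heven 0
    rw [neg_zero, plateau_eq_one (by simp)] at h0
    have h1 : ∫ ξ, m ξ = 1 := by
      simp only [mul_zero, Real.cos_zero, one_mul] at h0
      linarith
    simp only [sub_mul, one_mul]
    rw [integral_sub hmi (hcosi _), h1, smoothStep, heven]
  · calc (∫ ξ, |m ξ|) ≤ ∫ ξ, 2 * N * ‖g ξ‖ := integral_mono hmi.abs (hi0.const_mul _) hmle
      _ = 2 * N * I0 := integral_const_mul _ _
      _ ≤ (1 + 4 * I0 + 4 * Real.pi ^ 2 * I2) * N ^ 3 := by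
          have : N ≤ N ^ 3 := le_self_pow₀ hN1 (by norm_num)
          have h4 : 0 ≤ 4 * Real.pi ^ 2 * I2 := by positivity
          nlinarith [mul_nonneg hI0n (sub_nonneg.2 this), mul_nonneg h4 (show 0 ≤ N ^ 3 by positivity),
            mul_nonneg hI0n (show 0 ≤ N ^ 3 by positivity), show 0 ≤ N ^ 3 by positivity]
  · have hNv : N ≤ N ^ 3 := le_self_pow₀ hN1 (by norm_num)
    have hb1 : ∫ ξ, (1 - Real.cos (2 * Real.pi * ξ * (N * v))) * |m ξ| ≤ 4 * I0 * N := by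
      calc _ ≤ ∫ ξ, 4 * N * ‖g ξ‖ := by
            refine integral_mono (hdefi _) (hi0.const_mul _) fun ξ => ?_
            have h1 := Real.neg_one_le_cos (2 * Real.pi * ξ * (N * v))
            have h2 := Real.cos_le_one (2 * Real.pi * ξ * (N * v))
            have h3 := hmle ξ
            simp only
            nlinarith [abs_nonneg (m ξ)]
        _ = 4 * N * I0 := integral_const_mul _ _
        _ = _ := by ring
    have hb2 : ∫ ξ, (1 - Real.cos (2 * Real.pi * ξ * (N * v))) * |m ξ|
        ≤ 4 * Real.pi ^ 2 * I2 * N ^ 3 * v ^ 2 := by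
      calc _ ≤ ∫ ξ, (4 * Real.pi ^ 2 * N ^ 3 * v ^ 2) * (‖ξ‖ ^ 2 * ‖g ξ‖) := by
            refine integral_mono (hdefi _) (hi2.const_mul _) fun ξ => ?_
            have h1 := Real.one_sub_sq_div_two_le_cos (x := 2 * Real.pi * ξ * (N * v))
            have h2 := Real.cos_le_one (2 * Real.pi * ξ * (N * v))
            have h3 := hmle ξ
            simp only
            calc _ ≤ (2 * Real.pi * ξ * (N * v)) ^ 2 / 2 * (2 * N * ‖g ξ‖) := by
                  gcongr
                  linarith
              _ = _ := by rw [Real.norm_eq_abs, sq_abs]; ring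
        _ = _ := by rw [integral_const_mul]; ring
    rw [mul_min_of_nonneg _ _ (by positivity), mul_one]
    refine le_min (hb1.trans ?_) (hb2.trans ?_)
    · have h4 : 0 ≤ 4 * Real.pi ^ 2 * I2 := by positivity
      nlinarith [mul_nonneg hI0n (sub_nonneg.2 hNv), mul_nonneg h4 (show 0 ≤ N ^ 3 by positivity),
        show 0 ≤ N ^ 3 by positivity]
    · have : 4 * Real.pi ^ 2 * I2 ≤ 1 + 4 * I0 + 4 * Real.pi ^ 2 * I2 := by linarith
      gcongr

/-! ### From cosine defects to smoothed counts -/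

/-- The sum of `1 - cos (θ x_i)` over the coordinates of `x`. -/
noncomputable def cosDefect {n : ℕ} (x : Fin n → ℤ) (θ : ℝ) : ℝ :=
  ∑ i, (1 - Real.cos (θ * x i))

open MeasureTheory in
/-- If the cosine defects of two vectors are close, so are their sums of smooth steps. -/
theorem exists_abs_sum_smoothStep_sub_le : ∃ C : ℝ, 1 ≤ C ∧ ∀ (J n : ℕ) (x y : Fin n → ℤ)
    (ε₁ ε₀ : ℝ), (∀ θ, |cosDefect y θ - cosDefect x θ| ≤ ε₁ * cosDefect x θ + ε₀) →
    0 ≤ ε₁ → 0 ≤ ε₀ → ∀ t : ℝ,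
    |∑ i, smoothStep J (y i / t) - ∑ i, smoothStep J (x i / t)|
      ≤ C * (J + 1) ^ 3 * (ε₁ * ∑ i, min 1 ((x i / t : ℝ) ^ 2) + ε₀) := by
  obtain ⟨C, hC, h⟩ := exists_smoothStep_eq_integral
  refine ⟨C, hC, fun J n x y ε₁ ε₀ hxy hε₁ hε₀ t => ?_⟩
  obtain ⟨m, hmi, hs, hm0, hm2⟩ := h J
  set a : ℝ → ℝ := fun ξ => 2 * Real.pi * ξ * ((J + 1) / t) with ha
  have harg : ∀ (z : ℤ) (ξ : ℝ), 2 * Real.pi * ξ * ((J + 1) * (z / t)) = a ξ * z := fun z ξ => by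
    simp only [ha]; ring
  have hint : ∀ z : ℤ, ∀ f : ℝ → ℝ, Integrable f →
      Integrable (fun ξ => (1 - Real.cos (a ξ * z)) * f ξ) := fun z f hf =>
    hf.bdd_mul (c := 2) (by fun_prop) (Filter.Eventually.of_forall fun ξ => by
      have := Real.abs_cos_le_one (a ξ * z)
      rw [abs_le] at this
      rw [Real.norm_eq_abs, abs_le]
      constructor <;> linarith)
  have hsum : ∀ z : Fin n → ℤ, ∀ f : ℝ → ℝ, Integrable f →
      ∑ i, (∫ ξ, (1 - Real.cos (a ξ * z i)) * f ξ) = ∫ ξ, cosDefect z (a ξ) * f ξ :=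
    fun z f hf => by
      rw [← integral_finsetSum _ fun i _ => hint (z i) f hf]
      refine integral_congr_ae (Filter.Eventually.of_forall fun ξ => ?_)
      simp only [cosDefect, Finset.sum_mul]
  have hsumi : ∀ z : Fin n → ℤ, ∀ f : ℝ → ℝ, Integrable f →
      Integrable (fun ξ => cosDefect z (a ξ) * f ξ) := fun z f hf => by
    simp only [cosDefect, Finset.sum_mul]
    exact integrable_finsetSum _ fun i _ => hint (z i) f hf
  simp only [hs, harg]
  rw [hsum y m hmi, hsum x m hmi, ← integral_sub (hsumi y m hmi) (hsumi x m hmi)]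
  have hR : Integrable (fun ξ => ε₁ * (cosDefect x (a ξ) * |m ξ|) + ε₀ * |m ξ|) :=
    ((hsumi x _ hmi.abs).const_mul _).add (hmi.abs.const_mul _)
  calc _ ≤ ∫ ξ, |cosDefect y (a ξ) * m ξ - cosDefect x (a ξ) * m ξ| := abs_integral_le_integral_abs
    _ ≤ ∫ ξ, (ε₁ * (cosDefect x (a ξ) * |m ξ|) + ε₀ * |m ξ|) := by
        refine integral_mono ((hsumi y m hmi).sub (hsumi x m hmi)).abs hR fun ξ => ?_
        simp only
        rw [← sub_mul, abs_mul]
        nlinarith [hxy (a ξ), abs_nonneg (m ξ)]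
    _ = ε₁ * ∑ i, (∫ ξ, (1 - Real.cos (a ξ * x i)) * |m ξ|) + ε₀ * ∫ ξ, |m ξ| := by
        rw [integral_add ((hsumi x _ hmi.abs).const_mul _) (hmi.abs.const_mul _),
          integral_const_mul, integral_const_mul, hsum x _ hmi.abs]
    _ ≤ ε₁ * ∑ i, (C * (J + 1) ^ 3 * min 1 ((x i / t : ℝ) ^ 2)) + ε₀ * (C * (J + 1) ^ 3) := by
        gcongr with i
        simpa only [harg] using hm2 (x i / t)
    _ = _ := by rw [← Finset.mul_sum]; ring

/-! ### Powers and their increments -/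

section AbsPow

theorem absPow_nonneg (t p : ℝ) : 0 ≤ absPow t p := by
  rw [absPow]; split_ifs <;> positivity

theorem absPow_zero_left (p : ℝ) : absPow 0 p = 0 := by simp [absPow]

theorem absPow_of_ne {t : ℝ} (h : t ≠ 0) (p : ℝ) : absPow t p = |t| ^ p := by simp [absPow, h]

theorem absPow_le_absPow {a b p : ℝ} (hp : 0 ≤ p) (h : |a| ≤ |b|) : absPow a p ≤ absPow b p := by
  by_cases ha : a = 0
  · rw [ha, absPow_zero_left]; exact absPow_nonneg _ _
  · have hb : b ≠ 0 := fun hb => ha (by simpa [hb] using h)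
    rw [absPow_of_ne ha, absPow_of_ne hb]
    exact Real.rpow_le_rpow (abs_nonneg _) h hp

/-- Dilating the argument by a factor `r ≥ 1` multiplies the power by at most `r ^ 2`. -/
theorem absPow_le_sq_mul_absPow {a b p r : ℝ} (hp : 0 ≤ p) (hp2 : p ≤ 2) (hr : 1 ≤ r)
    (h : |a| ≤ r * |b|) : absPow a p ≤ r ^ 2 * absPow b p := by
  by_cases ha : a = 0
  · rw [ha, absPow_zero_left]; exact mul_nonneg (by positivity) (absPow_nonneg _ _)
  · have hb : b ≠ 0 := fun hb => ha (by simpa [hb] using h)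
    rw [absPow_of_ne ha, absPow_of_ne hb]
    calc |a| ^ p ≤ (r * |b|) ^ p := Real.rpow_le_rpow (abs_nonneg _) h hp
      _ = r ^ p * |b| ^ p := Real.mul_rpow (by positivity) (abs_nonneg _)
      _ ≤ r ^ (2 : ℝ) * |b| ^ p := by gcongr
      _ = _ := by rw [Real.rpow_two]

/-- `t ↦ |t| ^ p / t ^ 2` is non-increasing for `p ≤ 2`. -/
theorem absPow_mul_sq_le {a b p : ℝ} (hp2 : p ≤ 2) (h : |a| ≤ |b|) :
    absPow b p * a ^ 2 ≤ absPow a p * b ^ 2 := by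
  by_cases ha : a = 0
  · simp [ha, absPow_zero_left]
  · have hb : b ≠ 0 := fun hb => ha (by simpa [hb] using h)
    have ha' : 0 < |a| := abs_pos.2 ha
    have hb' : 0 < |b| := abs_pos.2 hb
    rw [absPow_of_ne ha, absPow_of_ne hb, ← sq_abs a, ← sq_abs b, ← Real.rpow_two, ← Real.rpow_two]
    have e : ∀ c : ℝ, 0 < c → c ^ (2 : ℝ) = c ^ p * c ^ (2 - p) := fun c hc => by
      rw [← Real.rpow_add hc, add_sub_cancel]
    rw [e _ ha', e _ hb']
    have : |a| ^ (2 - p) ≤ |b| ^ (2 - p) := Real.rpow_le_rpow ha'.le h (by linarith)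
    have h1 : 0 ≤ |a| ^ p := by positivity
    have h2 : 0 ≤ |b| ^ p := by positivity
    nlinarith [mul_nonneg h1 h2]

/-- The increment of `t ↦ t ^ p` from `t - 1` to `t`. -/
noncomputable def powStep (p : ℝ) (t : ℕ) : ℝ := absPow t p - absPow ((t - 1 : ℕ) : ℝ) p

theorem powStep_nonneg {p : ℝ} (hp : 0 ≤ p) (t : ℕ) : 0 ≤ powStep p t := by
  refine sub_nonneg.2 (absPow_le_absPow hp ?_)
  rw [Nat.abs_cast, Nat.abs_cast]
  exact_mod_cast Nat.sub_le t 1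

theorem sum_powStep (p : ℝ) {s t : ℕ} (h : s ≤ t) :
    ∑ j ∈ Finset.Ioc s t, powStep p j = absPow t p - absPow s p := by
  induction t, h using Nat.le_induction with
  | base => simp
  | succ t h ih =>
    rw [← Finset.insert_Ioc_right_eq_Ioc_add_one h, Finset.sum_insert (by simp), ih, powStep]
    simp

/-- Since t^p / t² does not increase, (t-1)^p ≥ t^p (1 - 1/t)² ≥ t^p (1 - 2/t). -/
theorem powStep_le {p : ℝ} (hp2 : p ≤ 2) {t : ℕ} (ht : 1 ≤ t) :
    powStep p t ≤ 2 * absPow t p / t := by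
  have h := absPow_mul_sq_le (a := ((t - 1 : ℕ) : ℝ)) (b := t) hp2 (by
    rw [Nat.abs_cast, Nat.abs_cast]; exact_mod_cast Nat.sub_le t 1)
  have ht' : (1 : ℝ) ≤ t := by exact_mod_cast ht
  have h0 := absPow_nonneg (t : ℝ) p
  rw [powStep, le_div_iff₀ (by linarith)]
  rw [Nat.cast_sub ht, Nat.cast_one] at *
  have h1 : absPow (t : ℝ) p * (t ^ 2 - 2 * t) ≤ absPow ((t : ℝ) - 1) p * (t : ℝ) ^ 2 := by
    nlinarith
  have h2 : absPow (t : ℝ) p * (t - 2) ≤ absPow ((t : ℝ) - 1) p * (t : ℝ) := by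
    by_contra hc
    push Not at hc
    nlinarith
  linarith

/-- Monotonicity of |u|^p for |u| ≥ t and of |u|^p / u² for |u| ≤ t show that t^p min(1, (u/t)²) ≤
|u|^p. The remaining 1/t sums to a logarithm. -/
theorem powStep_mul_min_le {p : ℝ} (hp2 : p ≤ 2) {t : ℕ} (ht : 1 ≤ t) (hp : 0 ≤ p) (u : ℝ) :
    powStep p t * min 1 ((u / t) ^ 2) ≤ 2 * absPow u p * (1 / t) := by
  have ht' : (0 : ℝ) < t := by exact_mod_cast ht
  have key : absPow t p * min 1 ((u / t) ^ 2) ≤ absPow u p := by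
    rcases le_total |u| |(t : ℝ)| with h | h
    · refine (mul_le_mul_of_nonneg_left (min_le_right _ _) (absPow_nonneg _ _)).trans ?_
      rw [div_pow, mul_div_assoc', div_le_iff₀ (by positivity)]
      exact absPow_mul_sq_le hp2 h
    · refine (mul_le_mul_of_nonneg_left (min_le_left _ _) (absPow_nonneg _ _)).trans ?_
      rw [mul_one]
      exact absPow_le_absPow hp h
  calc _ ≤ 2 * absPow t p / t * min 1 ((u / t) ^ 2) := by
        gcongr; exact powStep_le hp2 ht
    _ = 2 * (absPow t p * min 1 ((u / t) ^ 2)) * (1 / t) := by ring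
    _ ≤ _ := by gcongr

/-- The version for tail coordinates: the bound is quadratic in u, so its sum is governed by the
squared norm of the tail. -/
theorem powStep_mul_min_le_of_le {p : ℝ} (hp2 : p ≤ 2) {s t : ℕ} (hst : s < t) {u : ℝ}
    (hu : |u| ≤ s) :
    powStep p t * min 1 ((u / t) ^ 2) ≤ 2 * (absPow s p / s ^ 2 * u ^ 2) * (1 / t) := by
  have ht' : (0 : ℝ) < t := by exact_mod_cast (Nat.zero_le s).trans_lt hst
  rcases Nat.eq_zero_or_pos s with h0 | h0
  · subst h0
    have hu0 : u = 0 := by simpa using hu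
    simp [hu0]
  have hs' : (0 : ℝ) < s := by exact_mod_cast h0
  have key : absPow t p * min 1 ((u / t) ^ 2) ≤ absPow s p / s ^ 2 * u ^ 2 := by
    refine (mul_le_mul_of_nonneg_left (min_le_right _ _) (absPow_nonneg _ _)).trans ?_
    have h := absPow_mul_sq_le (a := (s : ℝ)) (b := t) hp2 (by
      rw [Nat.abs_cast, Nat.abs_cast]; exact_mod_cast hst.le)
    have h' : absPow (t : ℝ) p / t ^ 2 ≤ absPow s p / s ^ 2 := by
      rwa [div_le_div_iff₀ (by positivity) (by positivity)]
    rw [div_pow, mul_div_assoc', mul_comm, mul_div_assoc, mul_comm]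
    gcongr
  calc _ ≤ 2 * absPow t p / t * min 1 ((u / t) ^ 2) := by
        gcongr; exact powStep_le hp2 (by omega)
    _ = 2 * (absPow t p * min 1 ((u / t) ^ 2)) * (1 / t) := by ring
    _ ≤ _ := by gcongr

/-- The increments over a set of thresholds add up to at most the supremum minus the start. -/
theorem sum_powStep_mul_le {p : ℝ} (hp : 0 ≤ p) {s : ℕ} {b : ℝ} (hs : absPow s p ≤ b) (f : ℕ → ℝ)
    (hf1 : ∀ t, f t ≤ 1) (hf : ∀ t, s < t → b < absPow t p → f t ≤ 0) (T : ℕ) :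
    ∑ t ∈ Finset.Ioc s T, powStep p t * f t ≤ b - absPow s p := by
  rcases le_total T s with hT | hT
  · rw [Finset.Ioc_eq_empty (by omega)]; simpa using hs
  induction T, hT using Nat.le_induction with
  | base => simpa using hs
  | succ T hT ih =>
    -- Either the last term is not positive and can be dropped, or the level has not passed b and
    -- the telescoping sum of all increments is already small enough.
    by_cases hb : b < absPow (T + 1 : ℕ) p
    · rw [← Finset.insert_Ioc_right_eq_Ioc_add_one hT, Finset.sum_insert (by simp)]
      nlinarith [powStep_nonneg hp (T + 1), hf (T + 1) (by omega) hb]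
    · calc _ ≤ ∑ t ∈ Finset.Ioc s (T + 1), powStep p t := by
            refine Finset.sum_le_sum fun t _ => ?_
            nlinarith [powStep_nonneg hp t, hf1 t]
        _ = _ := sum_powStep p (by omega)
        _ ≤ _ := by linarith

end AbsPow

/-! ### Sums over the ranked coordinates -/

section Rearranged

variable {n : ℕ}

theorem abs_rearranged_antitone (x : Fin n → ℤ) {i j : Fin n} (h : i ≤ j) :
    |rearranged x j| ≤ |rearranged x i| := by
  have := Tuple.monotone_sort (fun i => -|x i|) h
  simpa [rearranged] using this

theorem sum_rearranged {M : Type*} [AddCommMonoid M] (x : Fin n → ℤ) (f : ℤ → M) :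
    ∑ i, f (rearranged x i) = ∑ i, f (x i) :=
  Equiv.sum_comp (Tuple.sort fun i => -|x i|) fun i => f (x i)

theorem rankedCoord_succ (x : Fin n → ℤ) (i : Fin n) :
    rankedCoord x (i + 1) = rearranged x i := by
  rw [rankedCoord, dif_pos ⟨by omega, by omega⟩]
  simp

theorem topMoment_eq_sum (x : Fin n → ℤ) {k : ℕ} (hk : k ≤ n) (p : ℝ) :
    topMoment x k p = ∑ i : Fin n with i.1 < k, absPow (rearranged x i) p := by
  symm
  refine Finset.sum_bij (fun i _ => (i : ℕ) + 1) ?_ ?_ ?_ ?_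
  · intro i hi
    simp only [Finset.mem_filter, Finset.mem_univ, true_and] at hi
    simp only [Finset.mem_Icc]; omega
  · intro i _ j _ h
    exact Fin.ext (by omega)
  · intro j hj
    simp only [Finset.mem_Icc] at hj
    exact ⟨⟨j - 1, by omega⟩, by simp only [Finset.mem_filter, Finset.mem_univ, true_and]; omega,
      by simp only; omega⟩
  · intro i _
    rw [rankedCoord_succ]

theorem tailNormSq_eq_sum (x : Fin n → ℤ) (k : ℕ) :
    tailNormSq x k = ∑ i : Fin n with k ≤ i.1, (rearranged x i : ℝ) ^ 2 := by
  symm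
  refine Finset.sum_bij (fun i _ => (i : ℕ) + 1) ?_ ?_ ?_ ?_
  · intro i hi
    simp only [Finset.mem_filter, Finset.mem_univ, true_and] at hi
    simp only [Finset.mem_Icc]; omega
  · intro i _ j _ h
    exact Fin.ext (by omega)
  · intro j hj
    simp only [Finset.mem_Icc] at hj
    exact ⟨⟨j - 1, by omega⟩, by simp only [Finset.mem_filter, Finset.mem_univ, true_and]; omega,
      by simp only; omega⟩
  · intro i _
    rw [rankedCoord_succ]

theorem topMoment_nonneg (x : Fin n → ℤ) (k : ℕ) (p : ℝ) : 0 ≤ topMoment x k p :=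
  Finset.sum_nonneg fun _ _ => absPow_nonneg _ _

end Rearranged

/-! ### The top moment from smoothed counts -/

section TopMoment

variable {n : ℕ}

theorem natAbs_rearranged_antitone (x : Fin n → ℤ) {i j : Fin n} (h : i ≤ j) :
    (rearranged x j).natAbs ≤ (rearranged x i).natAbs := by
  have := abs_rearranged_antitone x h
  rw [Int.abs_eq_natAbs, Int.abs_eq_natAbs] at this
  exact_mod_cast this

theorem absPow_natAbs (z : ℤ) (p : ℝ) : absPow (z.natAbs : ℝ) p = absPow (z : ℝ) p := by
  rw [Nat.cast_natAbs, Int.cast_abs]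
  simp [absPow]

theorem abs_intCast_eq_natAbs (z : ℤ) : |(z : ℝ)| = z.natAbs := by
  rw [Nat.cast_natAbs, Int.cast_abs]

/-- The moment of the top coordinates is bounded by a threshold and the excess over it. -/
theorem topMoment_le_add_sum_smoothStep (x : Fin n → ℤ) {k : ℕ} (hkn : k ≤ n) {p : ℝ} (hp : 0 ≤ p)
    (J s T : ℕ) (hT : ∀ i, (x i).natAbs ≤ T) :
    topMoment x k p ≤ k * absPow s p
      + ∑ t ∈ Finset.Ioc s T, powStep p t * ∑ i, smoothStep J (x i / t) := by
  have hT' : ∀ i, (rearranged x i).natAbs ≤ T := fun i => hT _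
  have hterm : ∀ i, absPow (rearranged x i) p ≤ absPow s p
      + ∑ t ∈ Finset.Ioc s T, powStep p t * smoothStep J (rearranged x i / t) := fun i => by
    set a := (rearranged x i).natAbs with ha
    have hn : ∀ t : ℕ, 0 ≤ powStep p t * smoothStep J (rearranged x i / t) := fun t =>
      mul_nonneg (powStep_nonneg hp t) (smoothStep_nonneg _ _)
    rw [← absPow_natAbs, ← ha]
    rcases le_total a s with h | h
    · have h1 : absPow a p ≤ absPow s p := absPow_le_absPow hp (by
        rw [Nat.abs_cast, Nat.abs_cast]; exact_mod_cast h)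
      linarith [Finset.sum_nonneg fun t (_ : t ∈ Finset.Ioc s T) => hn t]
    · rw [← sub_le_iff_le_add', ← sum_powStep p h]
      refine (Finset.sum_le_sum fun t ht => ?_).trans (Finset.sum_le_sum_of_subset_of_nonneg
        (Finset.Ioc_subset_Ioc_right (hT' i)) fun t _ _ => hn t)
      rw [Finset.mem_Ioc] at ht
      rw [smoothStep_eq_one, mul_one]
      have ht0 : (0 : ℝ) < t := by exact_mod_cast (by omega : 0 < t)
      rw [abs_div, abs_intCast_eq_natAbs, Nat.abs_cast, one_le_div ht0]
      exact_mod_cast ht.2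
  have hcard : (Finset.univ.filter fun i : Fin n => i.1 < k).card = k := by
    rw [Fin.card_filter_val_lt, min_eq_right hkn]
  rw [topMoment_eq_sum x hkn]
  calc _ ≤ ∑ i : Fin n with i.1 < k, (absPow s p
        + ∑ t ∈ Finset.Ioc s T, powStep p t * smoothStep J (rearranged x i / t)) :=
        Finset.sum_le_sum fun i _ => hterm i
    _ = k * absPow s p + ∑ i : Fin n with i.1 < k,
        ∑ t ∈ Finset.Ioc s T, powStep p t * smoothStep J (rearranged x i / t) := by
        rw [Finset.sum_add_distrib, Finset.sum_const, hcard, nsmul_eq_mul]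
    _ ≤ k * absPow s p + ∑ i,
        ∑ t ∈ Finset.Ioc s T, powStep p t * smoothStep J (rearranged x i / t) := by
        refine add_le_add le_rfl ?_
        refine Finset.sum_le_sum_of_subset_of_nonneg (Finset.filter_subset _ _) fun i _ _ => ?_
        exact Finset.sum_nonneg fun t _ =>
          mul_nonneg (powStep_nonneg hp t) (smoothStep_nonneg _ _)
    _ = _ := by
        rw [Finset.sum_comm]
        congr 1
        refine Finset.sum_congr rfl fun t _ => ?_
        rw [Finset.mul_sum, sum_rearranged x fun z => powStep p t * smoothStep J ((z : ℝ) / t)]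

theorem sum_eq_sum_lt_add_sum_le (f : Fin n → ℝ) (k : ℕ) :
    ∑ i, f i = ∑ i : Fin n with i.1 < k, f i + ∑ i : Fin n with k ≤ i.1, f i := by
  rw [← Finset.sum_filter_add_sum_filter_not Finset.univ fun i : Fin n => i.1 < k]
  simp only [not_lt]

/-- `x` has `k` coordinates that are at least `s` in absolute value, the others are at most `s`
and have a squared norm of at most `P k s ^ 2`. -/
structure HasThreshold (x : Fin n → ℤ) (k s : ℕ) (P : ℝ) : Prop where
  le : ∀ i : Fin n, i.1 < k → s ≤ (rearranged x i).natAbs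
  ge : ∀ i : Fin n, k ≤ i.1 → (rearranged x i).natAbs ≤ s
  tail : tailNormSq x k ≤ P * k * (s : ℝ) ^ 2

theorem exists_hasThreshold {x : Fin n → ℤ} {k : ℕ} (hk : 1 ≤ k) (hkn : k ≤ n) {P : ℝ}
    (h : tailNormSq x k ≤ P * k * rankedCoord x k ^ 2) : ∃ s, HasThreshold x k s P := by
  have hlt : k - 1 < n := by omega
  have hr : rankedCoord x k = rearranged x ⟨k - 1, hlt⟩ := by
    rw [← rankedCoord_succ]
    congr 1
    simp only
    omega
  refine ⟨(rearranged x ⟨k - 1, hlt⟩).natAbs, fun i hi => ?_, fun i hi => ?_, ?_⟩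
  · exact natAbs_rearranged_antitone x (Fin.le_def.2 (by simp only; omega))
  · exact natAbs_rearranged_antitone x (Fin.le_def.2 (by simp only; omega))
  · rwa [Nat.cast_natAbs, Int.cast_abs, sq_abs, ← hr]

variable {x : Fin n → ℤ} {k s : ℕ} {P p : ℝ}

theorem HasThreshold.mul_absPow_le (h : HasThreshold x k s P) (hkn : k ≤ n) (hp : 0 ≤ p) :
    k * absPow s p ≤ topMoment x k p := by
  have hcard : (Finset.univ.filter fun i : Fin n => i.1 < k).card = k := by
    rw [Fin.card_filter_val_lt, min_eq_right hkn]
  rw [topMoment_eq_sum x hkn, ← nsmul_eq_mul, ← hcard, hcard]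
  conv_lhs => rw [← hcard]
  refine Finset.card_nsmul_le_sum _ _ _ fun i hi => ?_
  rw [← absPow_natAbs]
  refine absPow_le_absPow hp ?_
  rw [Nat.abs_cast, Nat.abs_cast]
  exact_mod_cast h.le i (Finset.mem_filter.1 hi).2

/-- The tail condition bounds the sum by P k s^p, and each of the k top coordinates contributes at
least s^p to the moment. For s = 0 the weight is 0. -/
theorem HasThreshold.tail_mul_le (h : HasThreshold x k s P) (hkn : k ≤ n) (hp : 0 ≤ p)
    (hP : 0 ≤ P) :
    ∑ i : Fin n with k ≤ i.1, absPow s p / (s : ℝ) ^ 2 * (rearranged x i : ℝ) ^ 2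
      ≤ P * topMoment x k p := by
  rw [← Finset.mul_sum, ← tailNormSq_eq_sum]
  have h0 : 0 ≤ absPow (s : ℝ) p / (s : ℝ) ^ 2 := div_nonneg (absPow_nonneg _ _) (by positivity)
  calc _ ≤ absPow s p / (s : ℝ) ^ 2 * (P * k * (s : ℝ) ^ 2) := by gcongr; exact h.tail
    _ ≤ P * (k * absPow s p) := by
        rcases Nat.eq_zero_or_pos s with hs | hs
        · simp [hs, absPow_zero_left]
        · have : (s : ℝ) ≠ 0 := by positivity
          field_simp
          exact le_rfl
    _ ≤ _ := by gcongr; exact h.mul_absPow_le hkn hp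

/-- The excess of the smooth steps of one coordinate over the threshold. -/
theorem sum_powStep_mul_smoothStep_le (hp : 0 ≤ p) (hp2 : p ≤ 2) {J : ℕ} (hJ : 1 ≤ J) (s T : ℕ)
    (z : ℤ) : ∑ t ∈ Finset.Ioc s T, powStep p t * smoothStep J (z / t)
      ≤ max (absPow s p) ((1 + 1 / (J : ℝ)) ^ 2 * absPow z p) - absPow s p := by
  -- The step vanishes at every t ≥ (1 + 1/J)|z|. As p ≤ 2, the square of 1 + 1/J covers the effect
  -- of this dilation on the power.
  refine sum_powStep_mul_le hp (le_max_left _ _) (fun t => smoothStep J ((z : ℝ) / t))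
    (fun t => smoothStep_le_one _ _) (fun t hst ht => ?_) T
  refine (smoothStep_eq_zero ?_).le
  by_contra hc
  push Not at hc
  have ht0 : (0 : ℝ) < t := by exact_mod_cast (Nat.zero_le s).trans_lt hst
  have hJ0 : (0 : ℝ) < J := by exact_mod_cast hJ
  refine absurd (ht.trans_le' (le_max_right _ _)) (not_lt.2 ?_)
  refine absPow_le_sq_mul_absPow hp hp2 (by simp) ?_
  rw [abs_div, Nat.abs_cast, mul_div_assoc', lt_div_iff₀ ht0] at hc
  rw [Nat.abs_cast, one_add_div hJ0.ne', div_mul_eq_mul_div, le_div_iff₀ hJ0]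
  linarith

/-- A coordinate below the threshold contributes only if (1 + 1/J)|z| > s, and then at most ((1 +
1/J)² - 1) s^p. In that case s² ≤ (1 + 1/J)² z², which turns the contribution into a multiple of z²
that the tail norm controls. -/
theorem sum_powStep_mul_smoothStep_le_of_le (hp : 0 ≤ p) (hp2 : p ≤ 2) {J : ℕ} (hJ : 1 ≤ J)
    {s T : ℕ} {z : ℤ} (hz : z.natAbs ≤ s) :
    ∑ t ∈ Finset.Ioc s T, powStep p t * smoothStep J (z / t)
      ≤ ((1 + 1 / (J : ℝ)) ^ 2 - 1) * (1 + 1 / (J : ℝ)) ^ 2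
        * (absPow s p / (s : ℝ) ^ 2 * (z : ℝ) ^ 2) := by
  have hJ0 : (0 : ℝ) < J := by exact_mod_cast hJ
  have hκ : (1 : ℝ) ≤ (1 + 1 / (J : ℝ)) ^ 2 := one_le_pow₀ (by simp)
  have hs0 := absPow_nonneg (s : ℝ) p
  have hz' : |(z : ℝ)| ≤ s := by rw [abs_intCast_eq_natAbs]; exact_mod_cast hz
  by_cases hzs : (1 + 1 / (J : ℝ)) * |(z : ℝ)| ≤ s
  · calc _ ≤ (0 : ℝ) := Finset.sum_nonpos fun t ht => by
          rw [Finset.mem_Ioc] at ht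
          have ht0 : (0 : ℝ) < t := by exact_mod_cast (Nat.zero_le s).trans_lt ht.1
          have hst : (s : ℝ) ≤ t := by exact_mod_cast ht.1.le
          rw [smoothStep_eq_zero, mul_zero]
          rw [one_add_div hJ0.ne', div_mul_eq_mul_div, div_le_iff₀ hJ0] at hzs
          rw [abs_div, Nat.abs_cast, mul_div_assoc', div_le_iff₀ ht0]
          nlinarith
      _ ≤ _ := mul_nonneg (mul_nonneg (by linarith) (by linarith))
          (mul_nonneg (div_nonneg hs0 (by positivity)) (by positivity))
  · push Not at hzs
    have hspos : (0 : ℝ) < s := by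
      rcases Nat.eq_zero_or_pos s with h | h
      · rw [h, Nat.cast_zero] at hz' hzs
        rw [le_antisymm hz' (abs_nonneg _), mul_zero] at hzs
        exact absurd hzs (lt_irrefl _)
      · exact_mod_cast h
    have hsq : (s : ℝ) ^ 2 ≤ (1 + 1 / (J : ℝ)) ^ 2 * (z : ℝ) ^ 2 := by
      rw [← sq_abs (z : ℝ), ← mul_pow]
      exact pow_le_pow_left₀ hspos.le hzs.le 2
    calc _ ≤ max (absPow s p) ((1 + 1 / (J : ℝ)) ^ 2 * absPow z p) - absPow s p :=
          sum_powStep_mul_smoothStep_le hp hp2 hJ s T z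
      _ ≤ (1 + 1 / (J : ℝ)) ^ 2 * absPow s p - absPow s p := by
          gcongr
          refine max_le (le_mul_of_one_le_left hs0 hκ) ?_
          gcongr
          exact absPow_le_absPow hp (by rwa [Nat.abs_cast])
      _ = ((1 + 1 / (J : ℝ)) ^ 2 - 1) * (absPow s p / (s : ℝ) ^ 2 * (s : ℝ) ^ 2) := by
          field_simp
      _ ≤ ((1 + 1 / (J : ℝ)) ^ 2 - 1) * (absPow s p / (s : ℝ) ^ 2
            * ((1 + 1 / (J : ℝ)) ^ 2 * (z : ℝ) ^ 2)) := by
          have : 0 ≤ (1 + 1 / (J : ℝ)) ^ 2 - 1 := by linarith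
          gcongr
      _ = _ := by ring

/-- With a threshold `s`, the smooth steps overestimate the moment of the top coordinates by
little. -/
theorem HasThreshold.add_sum_smoothStep_le (h : HasThreshold x k s P) (hkn : k ≤ n) (hp : 0 ≤ p)
    (hp2 : p ≤ 2) (hP : 0 ≤ P) {J : ℕ} (hJ : 1 ≤ J) (T : ℕ) :
    k * absPow s p + ∑ t ∈ Finset.Ioc s T, powStep p t * ∑ i, smoothStep J (x i / t)
      ≤ (1 + 1 / (J : ℝ)) ^ 2 * (1 + ((1 + 1 / (J : ℝ)) ^ 2 - 1) * P) * topMoment x k p := by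
  have hJ0 : (0 : ℝ) < J := by exact_mod_cast hJ
  set κ : ℝ := (1 + 1 / (J : ℝ)) ^ 2 with hκd
  have hκ : 1 ≤ κ := one_le_pow₀ (by simp)
  have hcard : (Finset.univ.filter fun i : Fin n => i.1 < k).card = k := by
    rw [Fin.card_filter_val_lt, min_eq_right hkn]
  have hswap : ∑ t ∈ Finset.Ioc s T, powStep p t * ∑ i, smoothStep J (x i / t)
      = ∑ i, ∑ t ∈ Finset.Ioc s T, powStep p t * smoothStep J (rearranged x i / t) := by
    rw [Finset.sum_comm]
    refine Finset.sum_congr rfl fun t _ => ?_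
    rw [Finset.mul_sum, sum_rearranged x fun z => powStep p t * smoothStep J ((z : ℝ) / t)]
  rw [hswap, sum_eq_sum_lt_add_sum_le _ k]
  have h1 : ∑ i : Fin n with i.1 < k,
      ∑ t ∈ Finset.Ioc s T, powStep p t * smoothStep J (rearranged x i / t)
      ≤ κ * topMoment x k p - k * absPow s p := by
    calc _ ≤ ∑ i : Fin n with i.1 < k, (κ * absPow (rearranged x i) p - absPow s p) := by
          refine Finset.sum_le_sum fun i hi => ?_
          refine (sum_powStep_mul_smoothStep_le hp hp2 hJ s T _).trans (sub_le_sub_right ?_ _)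
          refine max_le ?_ le_rfl
          have hle : absPow s p ≤ absPow (rearranged x i) p := by
            refine absPow_le_absPow hp ?_
            rw [Nat.abs_cast, abs_intCast_eq_natAbs]
            exact_mod_cast h.le i (Finset.mem_filter.1 hi).2
          exact hle.trans (le_mul_of_one_le_left (absPow_nonneg _ _) hκ)
      _ = _ := by
          rw [Finset.sum_sub_distrib, ← Finset.mul_sum, Finset.sum_const, hcard, nsmul_eq_mul,
            topMoment_eq_sum x hkn]
  have h2 : ∑ i : Fin n with k ≤ i.1,
      ∑ t ∈ Finset.Ioc s T, powStep p t * smoothStep J (rearranged x i / t)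
      ≤ (κ - 1) * κ * (P * topMoment x k p) := by
    calc _ ≤ ∑ i : Fin n with k ≤ i.1, (κ - 1) * κ
            * (absPow s p / (s : ℝ) ^ 2 * (rearranged x i : ℝ) ^ 2) :=
          Finset.sum_le_sum fun i hi =>
            sum_powStep_mul_smoothStep_le_of_le hp hp2 hJ (h.ge i (Finset.mem_filter.1 hi).2)
      _ = (κ - 1) * κ * ∑ i : Fin n with k ≤ i.1,
            absPow s p / (s : ℝ) ^ 2 * (rearranged x i : ℝ) ^ 2 := by rw [Finset.mul_sum]
      _ ≤ _ := mul_le_mul_of_nonneg_left (h.tail_mul_le hkn hp hP)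
          (mul_nonneg (by linarith) (by linarith))
  calc _ ≤ k * absPow s p + ((κ * topMoment x k p - k * absPow s p)
        + (κ - 1) * κ * (P * topMoment x k p)) := by gcongr
    _ = _ := by ring

/-- This bounds the effect of the relative error of the counts: at each level t the top coordinates
cost a multiple of 1/t times the moment, and the tail costs P times as much. -/
theorem HasThreshold.sum_powStep_mul_min_le (h : HasThreshold x k s P) (hkn : k ≤ n) (hp : 0 ≤ p)
    (hp2 : p ≤ 2) (hP : 0 ≤ P) (T : ℕ) :
    ∑ t ∈ Finset.Ioc s T, powStep p t * ∑ i, min 1 ((x i / t : ℝ) ^ 2)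
      ≤ 2 * (1 + P) * topMoment x k p * ∑ t ∈ Finset.Ioc s T, (1 / t : ℝ) := by
  rw [Finset.mul_sum]
  refine Finset.sum_le_sum fun t ht => ?_
  rw [Finset.mem_Ioc] at ht
  rw [Finset.mul_sum, ← sum_rearranged x fun z => powStep p t * min 1 (((z : ℝ) / t) ^ 2),
    sum_eq_sum_lt_add_sum_le _ k]
  have h1 : ∑ i : Fin n with i.1 < k, powStep p t * min 1 ((rearranged x i / t : ℝ) ^ 2)
      ≤ 2 * topMoment x k p * (1 / t) := by
    rw [topMoment_eq_sum x hkn, Finset.mul_sum, Finset.sum_mul]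
    exact Finset.sum_le_sum fun i _ => powStep_mul_min_le hp2 (by omega) hp _
  have h2 : ∑ i : Fin n with k ≤ i.1, powStep p t * min 1 ((rearranged x i / t : ℝ) ^ 2)
      ≤ 2 * (P * topMoment x k p) * (1 / t) := by
    calc _ ≤ ∑ i : Fin n with k ≤ i.1,
          2 * (absPow s p / (s : ℝ) ^ 2 * (rearranged x i : ℝ) ^ 2) * (1 / t) :=
          Finset.sum_le_sum fun i hi => powStep_mul_min_le_of_le hp2 ht.1 (by
            rw [abs_intCast_eq_natAbs]
            exact_mod_cast h.ge i (Finset.mem_filter.1 hi).2)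
      _ ≤ _ := by
          rw [← Finset.sum_mul, ← Finset.mul_sum]
          gcongr
          exact h.tail_mul_le hkn hp hP
  calc _ ≤ _ := add_le_add h1 h2
    _ = _ := by ring

theorem absPow_le_topMoment (y : Fin n → ℤ) (hk : 1 ≤ k) (hkn : k ≤ n) (hp : 0 ≤ p) (i : Fin n) :
    absPow (y i) p ≤ topMoment y k p := by
  have hn : 0 < n := by omega
  set i0 : Fin n := ⟨0, hn⟩
  calc absPow (y i) p ≤ absPow (rearranged y i0) p := by
        refine absPow_le_absPow hp ?_
        have := abs_rearranged_antitone y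
          (Fin.le_def.2 (Nat.zero_le _) : i0 ≤ (Tuple.sort fun i => -|y i|).symm i)
        simp only [rearranged, Function.comp_apply, Equiv.apply_symm_apply] at this
        exact_mod_cast this
    _ ≤ _ := by
        rw [topMoment_eq_sum y hkn]
        exact Finset.single_le_sum (f := fun i => absPow (rearranged y i) p)
          (fun _ _ => absPow_nonneg _ _) (Finset.mem_filter.2 ⟨Finset.mem_univ _, hk⟩)

/-- If the smooth steps of `x` and `y` are close at every scale, and `x` has a threshold, then the
moment of the top coordinates of `y` is not much larger than that of `x`. -/
theorem HasThreshold.topMoment_le (h : HasThreshold x k s P) (hk : 1 ≤ k) (hkn : k ≤ n)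
    (hp : 0 ≤ p) (hp2 : p ≤ 2) (hP : 0 ≤ P) {J : ℕ} (hJ : 1 ≤ J) {y : Fin n → ℤ} {m : ℕ}
    (hy : ∀ i, |y i| ≤ (m : ℤ)) {D ε₁ ε₀ : ℝ} (hD : 0 ≤ D) (hε₁ : 0 ≤ ε₁) (hε₀ : 0 ≤ ε₀)
    (hclose : ∀ t : ℝ, |∑ i, smoothStep J (y i / t) - ∑ i, smoothStep J (x i / t)|
      ≤ D * (ε₁ * ∑ i, min 1 ((x i / t : ℝ) ^ 2) + ε₀)) :
    topMoment y k p ≤ ((1 + 1 / (J : ℝ)) ^ 2 * (1 + ((1 + 1 / (J : ℝ)) ^ 2 - 1) * P)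
      + D * ε₁ * (2 * (1 + P) * (1 + Real.log m))) * topMoment x k p
      + D * ε₀ * topMoment y k p := by
  have hn : 0 < n := by omega
  obtain ⟨i0, -, hi0⟩ := Finset.exists_max_image Finset.univ (fun i => (y i).natAbs)
    ⟨⟨0, hn⟩, Finset.mem_univ _⟩
  -- Stopping at the largest coordinate of `y` bounds the total weight of the levels by one term of
  -- its top moment, so the additive error of the counts costs only a small multiple of that moment.
  set T := (y i0).natAbs with hT
  have hTm : T ≤ m := by
    have := hy i0
    rw [Int.abs_eq_natAbs] at this
    exact_mod_cast this
  have hF := topMoment_nonneg x k p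
  have hharm : ∑ t ∈ Finset.Ioc s T, (1 / t : ℝ) ≤ 1 + Real.log m := by
    calc _ ≤ ∑ t ∈ Finset.Icc 1 m, (1 / t : ℝ) := by
          refine Finset.sum_le_sum_of_subset_of_nonneg (fun t ht => ?_) fun t _ _ => by positivity
          rw [Finset.mem_Ioc] at ht
          rw [Finset.mem_Icc]
          omega
      _ = ((harmonic m : ℚ) : ℝ) := by
          rw [harmonic_eq_sum_Icc]
          push_cast
          simp
      _ ≤ _ := harmonic_le_one_add_log m
  have hstep : ∑ t ∈ Finset.Ioc s T, powStep p t ≤ topMoment y k p := by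
    rcases le_total s T with hsT | hsT
    · rw [sum_powStep p hsT]
      have h1 := absPow_le_topMoment y hk hkn hp i0
      rw [← absPow_natAbs] at h1
      have h2 := absPow_nonneg (s : ℝ) p
      linarith
    · rw [Finset.Ioc_eq_empty (by omega), Finset.sum_empty]
      exact topMoment_nonneg y k p
  calc topMoment y k p ≤ k * absPow s p
        + ∑ t ∈ Finset.Ioc s T, powStep p t * ∑ i, smoothStep J (y i / t) :=
        topMoment_le_add_sum_smoothStep y hkn hp J s T fun i => hi0 i (Finset.mem_univ _)
    _ ≤ k * absPow s p + ∑ t ∈ Finset.Ioc s T, powStep p t * (∑ i, smoothStep J (x i / t)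
          + D * (ε₁ * ∑ i, min 1 ((x i / t : ℝ) ^ 2) + ε₀)) := by
        gcongr with t
        · exact powStep_nonneg hp t
        · linarith [(abs_le.1 (hclose t)).2]
    _ = (k * absPow s p + ∑ t ∈ Finset.Ioc s T, powStep p t * ∑ i, smoothStep J (x i / t))
        + D * ε₁ * ∑ t ∈ Finset.Ioc s T, powStep p t * ∑ i, min 1 ((x i / t : ℝ) ^ 2)
        + D * ε₀ * ∑ t ∈ Finset.Ioc s T, powStep p t := by
        rw [Finset.mul_sum (Finset.Ioc s T), Finset.mul_sum (Finset.Ioc s T), add_assoc, add_assoc,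
          ← Finset.sum_add_distrib, ← Finset.sum_add_distrib]
        congr 1
        refine Finset.sum_congr rfl fun t _ => ?_
        ring
    _ ≤ (1 + 1 / (J : ℝ)) ^ 2 * (1 + ((1 + 1 / (J : ℝ)) ^ 2 - 1) * P) * topMoment x k p
        + D * ε₁ * (2 * (1 + P) * topMoment x k p * (1 + Real.log m))
        + D * ε₀ * topMoment y k p := by
        gcongr
        · exact h.add_sum_smoothStep_le hkn hp hp2 hP hJ T
        · refine (h.sum_powStep_mul_min_le hkn hp hp2 hP T).trans ?_
          gcongr
    _ = _ := by ring

end TopMoment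

/-! ### Cosine defects from expected cosines -/

section CosProd

variable {n : ℕ}

/-- The expectation of `cos (θ ⟨ξ, x⟩)` for independent `ξ_i` that are `1` and `-1` with
probability `r / 2` each and `0` otherwise. -/
noncomputable def cosProd (r : ℝ) (x : Fin n → ℤ) (θ : ℝ) : ℝ :=
  ∏ i, (1 - r * (1 - Real.cos (θ * x i)))

theorem cosDefect_nonneg (x : Fin n → ℤ) (θ : ℝ) : 0 ≤ cosDefect x θ :=
  Finset.sum_nonneg fun _ _ => sub_nonneg.2 (Real.cos_le_one _)

theorem cosDefect_le (x : Fin n → ℤ) (θ : ℝ) : cosDefect x θ ≤ 2 * n := by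
  calc _ ≤ ∑ _i : Fin n, (2 : ℝ) := Finset.sum_le_sum fun i _ => by
        linarith [Real.neg_one_le_cos (θ * x i)]
    _ = _ := by simp [mul_comm]

theorem one_sub_sum_le_prod_one_sub_of_le_one {ι : Type*} (s : Finset ι) (a : ι → ℝ)
    (h0 : ∀ i, 0 ≤ a i) (h1 : ∀ i, a i ≤ 1) : 1 - ∑ i ∈ s, a i ≤ ∏ i ∈ s, (1 - a i) := by
  classical
  induction s using Finset.induction_on with
  | empty => simp
  | insert i s hi ih =>
    rw [Finset.sum_insert hi, Finset.prod_insert hi]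
    have hs : 0 ≤ ∑ i ∈ s, a i := Finset.sum_nonneg fun i _ => h0 i
    nlinarith [h0 i, h1 i, mul_nonneg (h0 i) hs,
      mul_le_mul_of_nonneg_left ih (sub_nonneg.2 (h1 i))]

theorem one_sub_le_cosProd {r : ℝ} (hr : 0 ≤ r) (hr2 : r ≤ 1 / 2) (x : Fin n → ℤ) (θ : ℝ) :
    1 - r * cosDefect x θ ≤ cosProd r x θ := by
  rw [cosDefect, Finset.mul_sum]
  refine one_sub_sum_le_prod_one_sub_of_le_one _ _ (fun i => ?_) fun i => ?_
  · exact mul_nonneg hr (sub_nonneg.2 (Real.cos_le_one _))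
  · nlinarith [Real.neg_one_le_cos (θ * x i), Real.cos_le_one (θ * x i)]

theorem cosProd_le_exp {r : ℝ} (hr : 0 ≤ r) (hr2 : r ≤ 1 / 2) (x : Fin n → ℤ) (θ : ℝ) :
    cosProd r x θ ≤ Real.exp (-(r * cosDefect x θ)) := by
  rw [cosDefect, Finset.mul_sum, ← Finset.sum_neg_distrib, Real.exp_sum]
  refine Finset.prod_le_prod (fun i _ => ?_) fun i _ => ?_
  · nlinarith [Real.neg_one_le_cos (θ * x i), Real.cos_le_one (θ * x i)]
  · linarith [Real.add_one_le_exp (-(r * (1 - Real.cos (θ * x i))))]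

/-- Among the rates `1/2, 1/4, …` there is one that suits a vector of cosine defect `b`. -/
theorem exists_rate {ε₁ ε₂ b : ℝ} (hε₁ : 0 < ε₁) (hε₂ : 0 ≤ ε₂) (h : 32 * ε₂ ≤ ε₁ ^ 2)
    (hb : 0 ≤ b) {L : ℕ} (hL : 4 * b ≤ ε₁ * 2 ^ (L + 1)) :
    ∃ l < L + 1, (1 / 2 : ℝ) ^ (l + 1) * b ≤ ε₁ / 4 ∧
      ε₂ / (1 / 2 : ℝ) ^ (l + 1) ≤ ε₁ * b / 4 + 2 * ε₂ := by
  have hex : ∃ l, (1 / 2 : ℝ) ^ (l + 1) * b ≤ ε₁ / 4 := ⟨L, by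
    rw [one_div_pow, one_div_mul_eq_div, div_le_iff₀ (by positivity)]
    linarith⟩
  classical
  -- This is the largest rate r with r b ≤ ε₁/4. If it is 1/2, then ε₂/r = 2ε₂. Otherwise the rate
  -- 2r is too large, so r b > ε₁/8 and ε₂/r ≤ 8ε₂b/ε₁ ≤ ε₁b/4.
  refine ⟨Nat.find hex, ?_, Nat.find_spec hex, ?_⟩
  · refine Nat.lt_succ_of_le (Nat.find_min' hex ?_)
    rw [one_div_pow, one_div_mul_eq_div, div_le_iff₀ (by positivity)]
    linarith
  · rcases Nat.eq_zero_or_pos (Nat.find hex) with h0 | h0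
    · rw [h0]
      have : 0 ≤ ε₁ * b / 4 := by positivity
      norm_num
      linarith
    · have hmin := Nat.find_min hex (Nat.sub_lt h0 one_pos)
      rw [not_le, Nat.sub_add_cancel (show 1 ≤ Nat.find hex from h0)] at hmin
      rw [div_le_iff₀ (by positivity), pow_succ]
      have hr : (0 : ℝ) < (1 / 2) ^ Nat.find hex := by positivity
      nlinarith [mul_pos hr hε₁, mul_nonneg hr.le hε₂]

/-- From exp(-rb) ≤ 1 - rb + (rb)², division by r gives b - a ≤ r b² + ε₂/r, and the choice of the
rate bounds both terms. -/
theorem sub_le_of_rate {ε₁ ε₂ a b r : ℝ} (hr : 0 < r) (hb : 0 ≤ b) (hε₁ : ε₁ ≤ 1)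
    (hrb : r * b ≤ ε₁ / 4) (hr2 : ε₂ / r ≤ ε₁ * b / 4 + 2 * ε₂)
    (h : 1 - r * a ≤ Real.exp (-(r * b)) + ε₂) : b - a ≤ ε₁ * b / 2 + 2 * ε₂ := by
  have h0 : 0 ≤ r * b := mul_nonneg hr.le hb
  have hexp := (abs_le.1 (Real.abs_exp_sub_one_sub_id_le (x := -(r * b)) (by
    rw [abs_neg, abs_of_nonneg h0]; linarith))).2
  rw [div_le_iff₀ hr] at hr2
  have h1 : r * (b - a) ≤ r * (ε₁ * b / 2 + 2 * ε₂) := by nlinarith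
  exact le_of_mul_le_mul_left h1 hr

/-- If the expected cosines of two vectors are close at all rates, so are the cosine defects. -/
theorem abs_cosDefect_sub_le {x y : Fin n → ℤ} {θ ε₁ ε₂ : ℝ} (hε₁ : 0 < ε₁) (hε₁' : ε₁ ≤ 1)
    (hε₂ : 0 ≤ ε₂) (h : 32 * ε₂ ≤ ε₁ ^ 2) {L : ℕ} (hL : 8 * n ≤ ε₁ * 2 ^ (L + 1))
    (hclose : ∀ l < L + 1, |cosProd ((1 / 2) ^ (l + 1)) y θ - cosProd ((1 / 2) ^ (l + 1)) x θ| ≤ ε₂) :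
    |cosDefect y θ - cosDefect x θ| ≤ ε₁ * cosDefect x θ + 4 * ε₂ := by
  have key : ∀ x y : Fin n → ℤ, (∀ l < L + 1,
      cosProd ((1 / 2) ^ (l + 1)) x θ ≤ cosProd ((1 / 2) ^ (l + 1)) y θ + ε₂) →
      cosDefect y θ - cosDefect x θ ≤ ε₁ * cosDefect y θ / 2 + 2 * ε₂ := fun x y hxy => by
    obtain ⟨l, hl, h1, h2⟩ := exists_rate (b := cosDefect y θ) hε₁ hε₂ h (cosDefect_nonneg y θ)
      (L := L) (by linarith [cosDefect_le y θ])
    have hr2 : (1 / 2 : ℝ) ^ (l + 1) ≤ 1 / 2 := by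
      rw [pow_succ]
      have : (1 / 2 : ℝ) ^ l ≤ 1 := pow_le_one₀ (by norm_num) (by norm_num)
      linarith
    refine sub_le_of_rate (by positivity) (cosDefect_nonneg y θ) hε₁' h1 h2 ?_
    have := one_sub_le_cosProd (by positivity) hr2 x θ
    have := cosProd_le_exp (by positivity) hr2 y θ
    have := hxy l hl
    linarith
  -- The rate is adapted to the subtracted-from vector, so its defect appears in the error. For `h1`
  -- this is `y`; the halved ε₁ in `key` leaves room to replace its defect by that of `x`.
  have h1 := key x y fun l hl => by linarith [(abs_le.1 (hclose l hl)).1]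
  have h2 := key y x fun l hl => by linarith [(abs_le.1 (hclose l hl)).2]
  have hx := cosDefect_nonneg x θ
  rw [abs_le]
  constructor
  · nlinarith
  · nlinarith

end CosProd

/-! ### Concentration and short seeds -/

section FiniteProbability

theorem sum_pi_prod {ι α R : Type*} [Fintype ι] [DecidableEq ι] [Fintype α] [CommSemiring R]
    (g : ι → α → R) : ∑ f : ι → α, ∏ i, g i (f i) = ∏ i, ∑ a, g i a := by
  rw [Finset.prod_univ_sum, Fintype.piFinset_univ]

/-- **Hoeffding's inequality** for finitely supported independent random variables. -/
theorem sum_filter_le_exp {ι α : Type*} [Fintype ι] [DecidableEq ι] [Fintype α] {w : ι → α → ℝ}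
    (hw0 : ∀ i a, 0 ≤ w i a) (hw1 : ∀ i, ∑ a, w i a = 1) (S : Finset ι) {Z : ι → α → ℝ}
    (hZ : ∀ i ∈ S, ∀ a, |Z i a| ≤ 2) (hmean : ∀ i ∈ S, ∑ a, w i a * Z i a = 0) {ε : ℝ}
    (hε : 0 ≤ ε) (hε4 : ε ≤ 4) :
    ∑ f : ι → α with S.card * ε ≤ ∑ i ∈ S, Z i (f i), ∏ i, w i (f i)
      ≤ Real.exp (-(S.card * ε ^ 2 / 16)) := by
  -- This minimizes 4u² - uε; `hε4` then gives |uZ| ≤ 1, as the quadratic bound on exp requires.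
  set u : ℝ := ε / 8 with hu
  have hmgf : ∀ i ∈ S, ∑ a, w i a * Real.exp (u * Z i a) ≤ Real.exp (4 * u ^ 2) := fun i hi => by
    calc _ ≤ ∑ a, (w i a + u * (w i a * Z i a) + 4 * u ^ 2 * w i a) := by
          refine Finset.sum_le_sum fun a _ => ?_
          have hZa := abs_le.1 (hZ i hi a)
          have h1 : |u * Z i a| ≤ 1 := by
            rw [abs_mul, abs_of_nonneg (by positivity)]
            nlinarith [hZ i hi a, abs_nonneg (Z i a)]
          have h2 := (abs_le.1 (Real.abs_exp_sub_one_sub_id_le h1)).2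
          have h3 : Z i a ^ 2 ≤ 4 := by nlinarith
          have h4 : (u * Z i a) ^ 2 ≤ 4 * u ^ 2 := by rw [mul_pow]; nlinarith [sq_nonneg u]
          nlinarith [hw0 i a, mul_le_mul_of_nonneg_left (h2.trans h4) (hw0 i a)]
      _ = 1 + 4 * u ^ 2 := by
          rw [Finset.sum_add_distrib, Finset.sum_add_distrib, ← Finset.mul_sum, ← Finset.mul_sum,
            hw1, hmean i hi]
          ring
      _ ≤ _ := by linarith [Real.add_one_le_exp (4 * u ^ 2)]
  calc _ ≤ ∑ f : ι → α with S.card * ε ≤ ∑ i ∈ S, Z i (f i), (∏ i, w i (f i))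
          * Real.exp (u * (∑ i ∈ S, Z i (f i) - S.card * ε)) := by
        refine Finset.sum_le_sum fun f hf => ?_
        refine le_mul_of_one_le_right (Finset.prod_nonneg fun i _ => hw0 _ _) ?_
        exact Real.one_le_exp (mul_nonneg (by positivity) (sub_nonneg.2 (Finset.mem_filter.1 hf).2))
    _ ≤ ∑ f : ι → α, (∏ i, w i (f i)) * Real.exp (u * (∑ i ∈ S, Z i (f i) - S.card * ε)) :=
        Finset.sum_le_sum_of_subset_of_nonneg (Finset.filter_subset _ _) fun f _ _ =>
          mul_nonneg (Finset.prod_nonneg fun i _ => hw0 _ _) (Real.exp_nonneg _)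
    _ = Real.exp (-(u * (S.card * ε))) * ∑ f : ι → α,
          ∏ i, (w i (f i) * if i ∈ S then Real.exp (u * Z i (f i)) else 1) := by
        rw [Finset.mul_sum]
        refine Finset.sum_congr rfl fun f _ => ?_
        rw [Finset.prod_mul_distrib, Finset.prod_ite_mem, Finset.univ_inter, ← Real.exp_sum,
          mul_left_comm, ← Real.exp_add, ← Finset.mul_sum]
        congr 2
        ring
    _ ≤ Real.exp (-(u * (S.card * ε))) * ∏ i, if i ∈ S then Real.exp (4 * u ^ 2) else 1 := by
        rw [sum_pi_prod fun i a => w i a * if i ∈ S then Real.exp (u * Z i a) else 1]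
        gcongr with i
        · intro i _
          refine Finset.sum_nonneg fun a _ => mul_nonneg (hw0 i a) ?_
          split_ifs <;> positivity
        · split_ifs with hi
          · exact hmgf i hi
          · simp [hw1]
    _ = _ := by
        rw [Finset.prod_ite_mem, Finset.univ_inter, Finset.prod_const, ← Real.exp_nat_mul,
          ← Real.exp_add, hu]
        congr 1
        ring

theorem sum_filter_abs_le_exp {ι α : Type*} [Fintype ι] [DecidableEq ι] [Fintype α]
    {w : ι → α → ℝ} (hw0 : ∀ i a, 0 ≤ w i a) (hw1 : ∀ i, ∑ a, w i a = 1) (S : Finset ι)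
    {Z : ι → α → ℝ} (hZ : ∀ i ∈ S, ∀ a, |Z i a| ≤ 2)
    (hmean : ∀ i ∈ S, ∑ a, w i a * Z i a = 0) {ε : ℝ} (hε : 0 ≤ ε) (hε4 : ε ≤ 4) :
    ∑ f : ι → α with S.card * ε ≤ |∑ i ∈ S, Z i (f i)|, ∏ i, w i (f i)
      ≤ 2 * Real.exp (-(S.card * ε ^ 2 / 16)) := by
  classical
  have h1 := sum_filter_le_exp hw0 hw1 S hZ hmean hε hε4
  have h2 := sum_filter_le_exp hw0 hw1 S (Z := fun i a => -Z i a) (by simpa using hZ)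
    (fun i hi => by simpa using hmean i hi) hε hε4
  have hsub : (Finset.univ.filter fun f : ι → α => S.card * ε ≤ |∑ i ∈ S, Z i (f i)|)
      ⊆ (Finset.univ.filter fun f : ι → α => S.card * ε ≤ ∑ i ∈ S, Z i (f i))
        ∪ Finset.univ.filter fun f : ι → α => S.card * ε ≤ ∑ i ∈ S, -Z i (f i) := fun f hf => by
    simp only [Finset.mem_union, Finset.mem_filter, Finset.mem_univ, true_and,
      Finset.sum_neg_distrib] at hf ⊢
    exact le_abs.1 hf
  have hn : ∀ f : ι → α, 0 ≤ ∏ i, w i (f i) := fun f => Finset.prod_nonneg fun i _ => hw0 _ _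
  refine (Finset.sum_le_sum_of_subset_of_nonneg hsub fun f _ _ => hn f).trans ?_
  have h3 := Finset.sum_union_inter (f := fun f : ι → α => ∏ i, w i (f i))
    (s₁ := Finset.univ.filter fun f : ι → α => S.card * ε ≤ ∑ i ∈ S, Z i (f i))
    (s₂ := Finset.univ.filter fun f : ι → α => S.card * ε ≤ ∑ i ∈ S, -Z i (f i))
  exact (le_add_of_nonneg_right (Finset.sum_nonneg fun f _ => hn f)).trans
    (h3.le.trans ((add_le_add h1 h2).trans (two_mul _).ge))

/-- Few seeds suffice: if every input is bad for a small fraction of a probability space, then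
there is a short list of its points of which every input is bad for a small fraction. -/
theorem exists_forall_mul_card_le {Ω X κ : Type*} [Fintype Ω] [Fintype X] [Fintype κ]
    [DecidableEq κ] {w : Ω → ℝ} (hw0 : ∀ ω, 0 ≤ w ω) (hw1 : ∑ ω, w ω = 1) (bad : X → Ω → Prop)
    [∀ x, DecidablePred (bad x)] (Q : ℕ)
    (hbad : ∀ x, ∑ ω with bad x ω, w ω ≤ (1 / 2) ^ Q)
    (hcard : Fintype.card X < 2 ^ Fintype.card κ) :
    ∃ f : κ → Ω, ∀ x, Q * (Finset.univ.filter fun i => bad x (f i)).card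
      ≤ 2 * Fintype.card κ := by
  -- The product is 2 to the power Q times the number of bad entries of the list. The entries are
  -- independent and each factor has mean at most 2, so even the sum over all inputs has mean below
  -- 4 to the length of the list.
  have hexp : ∀ x, ∑ f : κ → Ω, (∏ i, w (f i)) * ∏ i, (if bad x (f i) then (2 : ℝ) ^ Q else 1)
      ≤ 2 ^ Fintype.card κ := fun x => by
    simp only [← Finset.prod_mul_distrib]
    rw [sum_pi_prod fun (_ : κ) ω => w ω * if bad x ω then (2 : ℝ) ^ Q else 1, Finset.prod_const,
      Finset.card_univ]
    refine pow_le_pow_left₀ (Finset.sum_nonneg fun ω _ => mul_nonneg (hw0 ω) ?_) ?_ _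
    · split_ifs <;> positivity
    · calc _ ≤ ∑ ω, (w ω + if bad x ω then w ω * 2 ^ Q else 0) := by
            refine Finset.sum_le_sum fun ω _ => ?_
            split_ifs
            · linarith [hw0 ω]
            · linarith
        _ = 1 + (∑ ω with bad x ω, w ω) * 2 ^ Q := by
            rw [Finset.sum_add_distrib, hw1, ← Finset.sum_filter, Finset.sum_mul]
        _ ≤ 1 + (1 / 2) ^ Q * 2 ^ Q := by gcongr; exact hbad x
        _ = 2 := by rw [← mul_pow]; norm_num
  have hW1 : ∑ f : κ → Ω, ∏ i, w (f i) = 1 := by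
    rw [sum_pi_prod fun (_ : κ) ω => w ω]; simp [hw1]
  have hlt : ∑ f : κ → Ω, (∏ i, w (f i))
        * ∑ x, ∏ i, (if bad x (f i) then (2 : ℝ) ^ Q else 1)
      < ∑ f : κ → Ω, (∏ i, w (f i)) * 4 ^ Fintype.card κ := by
    rw [← Finset.sum_mul, hW1, one_mul]
    calc _ = ∑ x, ∑ f : κ → Ω, (∏ i, w (f i))
            * ∏ i, (if bad x (f i) then (2 : ℝ) ^ Q else 1) := by
          simp only [Finset.mul_sum]
          exact Finset.sum_comm
      _ ≤ ∑ _x : X, (2 : ℝ) ^ Fintype.card κ := Finset.sum_le_sum fun x _ => hexp x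
      _ = Fintype.card X * 2 ^ Fintype.card κ := by
          rw [Finset.sum_const, Finset.card_univ, nsmul_eq_mul]
      _ < 2 ^ Fintype.card κ * 2 ^ Fintype.card κ := by
          gcongr
          exact_mod_cast hcard
      _ = _ := by rw [← mul_pow]; norm_num
  obtain ⟨f, -, hf⟩ := Finset.exists_lt_of_sum_lt hlt
  refine ⟨f, fun x => ?_⟩
  have h1 := lt_of_mul_lt_mul_left hf (Finset.prod_nonneg fun i _ => hw0 _)
  have h2 : ∏ i, (if bad x (f i) then (2 : ℝ) ^ Q else 1) < 4 ^ Fintype.card κ := by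
    refine lt_of_le_of_lt ?_ h1
    refine Finset.single_le_sum (f := fun x => ∏ i, (if bad x (f i) then (2 : ℝ) ^ Q else 1))
      (fun x _ => Finset.prod_nonneg fun i _ => ?_) (Finset.mem_univ x)
    split_ifs <;> positivity
  rw [← Finset.prod_filter, Finset.prod_const, ← pow_mul, show (4 : ℝ) = 2 ^ 2 by norm_num,
    ← pow_mul] at h2
  exact (Nat.pow_lt_pow_iff_right (by norm_num : 1 < 2)).1 (by exact_mod_cast h2) |>.le

end FiniteProbability

/-! ### Random sign rows -/

section SignRows

variable {n : ℕ}

/-- The distribution of a random sign that is nonzero with probability `r`. -/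
noncomputable def signWeight (r : ℝ) (a : SignType) : ℝ := if a = 0 then 1 - r else r / 2

theorem signWeight_nonneg {r : ℝ} (hr : 0 ≤ r) (hr1 : r ≤ 1) (a : SignType) :
    0 ≤ signWeight r a := by
  rw [signWeight]; split_ifs <;> linarith

theorem sum_signType {M : Type*} [AddCommMonoid M] (f : SignType → M) :
    ∑ a, f a = f 0 + (f (-1) + f 1) := by
  have : (Finset.univ : Finset SignType) = {0, -1, 1} := rfl
  rw [this, Finset.sum_insert (by decide), Finset.sum_insert (by decide), Finset.sum_singleton]

theorem sum_signWeight (r : ℝ) : ∑ a, signWeight r a = 1 := by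
  rw [sum_signType]; simp [signWeight]

/-- The inner product of a vector of signs with an integer vector. -/
def signDot (ξ : Fin n → SignType) (x : Fin n → ℤ) : ℤ := ∑ i, (ξ i : ℤ) * x i

theorem abs_signDot_le (ξ : Fin n → SignType) {x : Fin n → ℤ} {m : ℕ}
    (hx : ∀ i, |x i| ≤ (m : ℤ)) : |signDot ξ x| ≤ (n * m : ℕ) := by
  calc _ ≤ ∑ i, |(ξ i : ℤ) * x i| := Finset.abs_sum_le_sum_abs _ _
    _ ≤ ∑ _i : Fin n, (m : ℤ) := by
        refine Finset.sum_le_sum fun i _ => ?_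
        have h : |((ξ i : SignType) : ℤ)| ≤ 1 := by
          generalize ξ i = a
          revert a
          decide
        rw [abs_mul]
        nlinarith [hx i, abs_nonneg (x i)]
    _ = _ := by simp

/-- The distribution of a row of independent random signs. -/
noncomputable def rowWeight (r : ℝ) (ξ : Fin n → SignType) : ℝ := ∏ i, signWeight r (ξ i)

theorem rowWeight_nonneg {r : ℝ} (hr : 0 ≤ r) (hr1 : r ≤ 1) (ξ : Fin n → SignType) :
    0 ≤ rowWeight r ξ :=
  Finset.prod_nonneg fun _ _ => signWeight_nonneg hr hr1 _

theorem sum_rowWeight (r : ℝ) : ∑ ξ : Fin n → SignType, rowWeight r ξ = 1 := by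
  simp only [rowWeight]
  rw [sum_pi_prod fun _ a => signWeight r a]
  simp [sum_signWeight]

/-- The exponential of iθ⟨ξ, x⟩ factors over the independent entries, and an entry of rate r has the
real mean 1 - r + r cos(θ x_i). -/
theorem sum_rowWeight_mul_cos (r : ℝ) (x : Fin n → ℤ) (θ : ℝ) :
    ∑ ξ : Fin n → SignType, rowWeight r ξ * Real.cos (θ * signDot ξ x) = cosProd r x θ := by
  have h : ∑ ξ : Fin n → SignType, (rowWeight r ξ : ℂ)
      * Complex.exp ((θ * signDot ξ x : ℝ) * Complex.I) = (cosProd r x θ : ℂ) := by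
    calc _ = ∑ ξ : Fin n → SignType, ∏ i, ((signWeight r (ξ i) : ℂ)
          * Complex.exp ((θ * (((ξ i : ℤ) : ℝ) * x i) : ℝ) * Complex.I)) := by
          refine Finset.sum_congr rfl fun ξ _ => ?_
          rw [Finset.prod_mul_distrib, rowWeight, Complex.ofReal_prod, ← Complex.exp_sum,
            ← Finset.sum_mul, ← Complex.ofReal_sum, ← Finset.mul_sum, signDot]
          push_cast
          rfl
      _ = _ := by
          rw [sum_pi_prod fun i (a : SignType) => (signWeight r a : ℂ)
            * Complex.exp ((θ * (((a : ℤ) : ℝ) * x i) : ℝ) * Complex.I), cosProd,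
            Complex.ofReal_prod]
          refine Finset.prod_congr rfl fun i _ => ?_
          have hc := Complex.two_cos ((θ * x i : ℝ) : ℂ)
          rw [sum_signType]
          simp [signWeight] at hc ⊢
          linear_combination -(r : ℂ) / 2 * hc
  have h2 := congrArg Complex.re h
  rw [Complex.ofReal_re, Complex.re_sum] at h2
  rw [← h2]
  refine Finset.sum_congr rfl fun ξ _ => ?_
  rw [Complex.re_ofReal_mul, Complex.exp_ofReal_mul_I_re]

theorem abs_cosProd_le_one {r : ℝ} (hr : 0 ≤ r) (hr1 : r ≤ 1) (x : Fin n → ℤ) (θ : ℝ) :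
    |cosProd r x θ| ≤ 1 := by
  rw [← sum_rowWeight_mul_cos]
  refine (Finset.abs_sum_le_sum_abs _ _).trans ?_
  rw [← sum_rowWeight (n := n) r]
  refine Finset.sum_le_sum fun ξ _ => ?_
  rw [abs_mul, abs_of_nonneg (rowWeight_nonneg hr hr1 ξ)]
  exact mul_le_of_le_one_right (rowWeight_nonneg hr hr1 ξ) (Real.abs_cos_le_one _)

theorem abs_cos_signDot_sub_le (ξ : Fin n → SignType) {x : Fin n → ℤ} {m : ℕ}
    (hx : ∀ i, |x i| ≤ (m : ℤ)) (θ θ' : ℝ) :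
    |Real.cos (θ * signDot ξ x) - Real.cos (θ' * signDot ξ x)| ≤ |θ - θ'| * (n * m) := by
  refine (Real.abs_cos_sub_cos_le _ _).trans ?_
  rw [← sub_mul, abs_mul]
  gcongr
  exact_mod_cast abs_signDot_le ξ hx

theorem abs_cosProd_sub_le {r : ℝ} (hr : 0 ≤ r) (hr1 : r ≤ 1) {x : Fin n → ℤ} {m : ℕ}
    (hx : ∀ i, |x i| ≤ (m : ℤ)) (θ θ' : ℝ) :
    |cosProd r x θ - cosProd r x θ'| ≤ |θ - θ'| * (n * m) := by
  rw [← sum_rowWeight_mul_cos, ← sum_rowWeight_mul_cos, ← Finset.sum_sub_distrib]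
  calc _ ≤ ∑ ξ : Fin n → SignType, rowWeight r ξ * (|θ - θ'| * (n * m)) := by
        refine (Finset.abs_sum_le_sum_abs _ _).trans (Finset.sum_le_sum fun ξ _ => ?_)
        rw [← mul_sub, abs_mul, abs_of_nonneg (rowWeight_nonneg hr hr1 ξ)]
        exact mul_le_mul_of_nonneg_left (abs_cos_signDot_sub_le ξ hx θ θ')
          (rowWeight_nonneg hr hr1 ξ)
    _ = _ := by rw [← Finset.sum_mul, sum_rowWeight, one_mul]

theorem cos_mul_intCast_periodic (z : ℤ) :
    Function.Periodic (fun θ : ℝ => Real.cos (θ * z)) (2 * Real.pi) := fun θ => by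
  simp only
  rw [add_mul, mul_comm (2 * Real.pi) (z : ℝ), Real.cos_add_int_mul_two_pi]

theorem cosProd_periodic (r : ℝ) (x : Fin n → ℤ) :
    Function.Periodic (cosProd r x) (2 * Real.pi) := fun θ => by
  simp only [cosProd]
  refine Finset.prod_congr rfl fun i _ => ?_
  have := cos_mul_intCast_periodic (x i) θ
  simp only at this
  rw [this]

/-- A bound on a grid for a periodic Lipschitz function extends to all arguments. -/
theorem abs_le_of_grid {f : ℝ → ℝ} (hper : Function.Periodic f (2 * Real.pi)) {K b : ℝ}
    (hK : 0 ≤ K) (hlip : ∀ θ θ', |f θ - f θ'| ≤ K * |θ - θ'|) {M : ℕ} (hM : 0 < M)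
    (hgrid : ∀ g : Fin M, |f (2 * Real.pi * g / M)| ≤ b) (θ : ℝ) :
    |f θ| ≤ b + K * (2 * Real.pi / M) := by
  have hM' : (0 : ℝ) < M := by exact_mod_cast hM
  set z : ℤ := ⌊θ * M / (2 * Real.pi)⌋ with hz
  have hmod0 : 0 ≤ z % M := Int.emod_nonneg _ (by omega)
  have hmodlt : z % M < M := Int.emod_lt_of_pos _ (by omega)
  have hg := hgrid ⟨(z % M).toNat, by omega⟩
  have hcast : (((z % M).toNat : ℕ) : ℝ) = z - M * (z / M : ℤ) := by
    have h1 : (((z % M).toNat : ℕ) : ℤ) = z - M * (z / M) := by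
      rw [Int.toNat_of_nonneg hmod0]
      linarith [Int.emod_add_mul_ediv z M]
    exact_mod_cast h1
  have heq : 2 * Real.pi * (((z % M).toNat : ℕ) : ℝ) / M
      = 2 * Real.pi * z / M - (z / M : ℤ) * (2 * Real.pi) := by
    rw [hcast]; field_simp
  simp only at hg
  rw [heq, hper.sub_int_mul_eq] at hg
  have hpi : 0 < 2 * Real.pi := by positivity
  have hdist : |θ - 2 * Real.pi * z / M| ≤ 2 * Real.pi / M := by
    have h1 := Int.floor_le (θ * M / (2 * Real.pi))
    have h2 := Int.lt_floor_add_one (θ * M / (2 * Real.pi))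
    rw [← hz, le_div_iff₀ hpi] at h1
    rw [← hz, div_lt_iff₀ hpi] at h2
    rw [abs_of_nonneg]
    · rw [sub_le_iff_le_add, ← add_div, le_div_iff₀ hM']
      linarith
    · rw [sub_nonneg, div_le_iff₀ hM']
      linarith
  calc |f θ| = |f (2 * Real.pi * z / M) + (f θ - f (2 * Real.pi * z / M))| := by ring_nf
    _ ≤ |f (2 * Real.pi * z / M)| + |f θ - f (2 * Real.pi * z / M)| := abs_add_le _ _
    _ ≤ b + K * (2 * Real.pi / M) := by
        gcongr
        exact (hlip _ _).trans (by gcongr)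

/-- Sketches `v l j` at rates `1/2, 1/4, …` agree with `x` if at each rate and frequency their
cosines average to about the expected value. -/
def Agrees {L R : ℕ} (v : Fin L → Fin R → ℤ) (x : Fin n → ℤ) (e : ℝ) : Prop :=
  ∀ (l : Fin L) (θ : ℝ),
    |∑ j, (Real.cos (θ * v l j) - cosProd ((1 / 2) ^ (l.1 + 1)) x θ)| ≤ R * e

theorem half_pow_le_one (l : ℕ) : (1 / 2 : ℝ) ^ (l + 1) ≤ 1 :=
  pow_le_one₀ (by norm_num) (by norm_num)

theorem Agrees.abs_cosProd_sub_le {L R : ℕ} {v : Fin L → Fin R → ℤ} {x y : Fin n → ℤ} {e : ℝ}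
    (hR : 0 < R) (hx : Agrees v x e) (hy : Agrees v y e) {l : ℕ} (hl : l < L) (θ : ℝ) :
    |cosProd ((1 / 2) ^ (l + 1)) y θ - cosProd ((1 / 2) ^ (l + 1)) x θ| ≤ 2 * e := by
  have h1 := abs_le.1 (hx ⟨l, hl⟩ θ)
  have h2 := abs_le.1 (hy ⟨l, hl⟩ θ)
  rw [Finset.sum_sub_distrib, Finset.sum_const, Finset.card_univ, Fintype.card_fin,
    nsmul_eq_mul] at h1 h2
  have hR' : (0 : ℝ) < R := by exact_mod_cast hR
  rw [abs_le]
  constructor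
  · refine le_of_mul_le_mul_left ?_ hR'
    linarith
  · refine le_of_mul_le_mul_left ?_ hR'
    linarith

/-- Random sign rows agree with a fixed vector with high probability. -/
theorem sum_not_agrees_le {L R M m : ℕ} (hM : 0 < M) {e : ℝ} (he : 0 < e) (he4 : e ≤ 4)
    (hMe : 2 * (n * m) * (2 * Real.pi / M) ≤ e) {x : Fin n → ℤ} (hx : ∀ i, |x i| ≤ (m : ℤ))
    [DecidablePred fun ω : Fin L × Fin R → Fin n → SignType =>
      ¬ Agrees (fun l j => signDot (ω (l, j)) x) x (2 * e)] :
    ∑ ω : Fin L × Fin R → Fin n → SignType with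
        ¬ Agrees (fun l j => signDot (ω (l, j)) x) x (2 * e),
      ∏ i, rowWeight ((1 / 2) ^ (i.1.1 + 1)) (ω i)
      ≤ L * M * (2 * Real.exp (-(R * e ^ 2 / 16))) := by
  classical
  have hw0 : ∀ (i : Fin L × Fin R) (a : Fin n → SignType),
      0 ≤ rowWeight ((1 / 2) ^ (i.1.1 + 1)) a := fun i a =>
    rowWeight_nonneg (by positivity) (half_pow_le_one _) a
  set Z : ℝ → Fin L × Fin R → (Fin n → SignType) → ℝ := fun θ i a =>
    Real.cos (θ * signDot a x) - cosProd ((1 / 2) ^ (i.1.1 + 1)) x θ with hZ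
  set E : Fin L × Fin M → (Fin L × Fin R → Fin n → SignType) → Prop := fun q ω =>
    (({q.1} ×ˢ Finset.univ : Finset (Fin L × Fin R)).card : ℝ) * e
      ≤ |∑ i ∈ ({q.1} ×ˢ Finset.univ : Finset (Fin L × Fin R)),
        Z (2 * Real.pi * q.2 / M) i (ω i)| with hE
  have hprob : ∀ q, ∑ ω with E q ω, ∏ i, rowWeight ((1 / 2) ^ (i.1.1 + 1)) (ω i)
      ≤ 2 * Real.exp (-(R * e ^ 2 / 16)) := fun q => by
    have h := sum_filter_abs_le_exp hw0 (fun i => sum_rowWeight _)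
      ({q.1} ×ˢ Finset.univ : Finset (Fin L × Fin R)) (Z := Z (2 * Real.pi * q.2 / M))
      (fun i _ a => (abs_sub _ _).trans ?_) (fun i _ => ?_) he.le he4
    · refine h.trans_eq ?_
      rw [Finset.card_product]
      simp
    · have h1 := Real.abs_cos_le_one (2 * Real.pi * q.2 / M * signDot a x)
      have h2 := abs_cosProd_le_one (r := (1 / 2) ^ (i.1.1 + 1)) (by positivity)
        (half_pow_le_one _) x (2 * Real.pi * q.2 / M)
      linarith
    · simp only [hZ, mul_sub]
      rw [Finset.sum_sub_distrib, sum_rowWeight_mul_cos, ← Finset.sum_mul, sum_rowWeight, one_mul,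
        sub_self]
  have hcover : ∀ ω, ¬ Agrees (fun l j => signDot (ω (l, j)) x) x (2 * e) → ∃ q, E q ω :=
    fun ω hω => by
      by_contra hne
      push Not at hne
      refine hω fun l θ => ?_
      -- Each sampled cosine and each expectation is nm-Lipschitz in θ, hence the constant 2nm per
      -- row. Passing from the grid to all θ costs a second `e`.
      have hgrid := abs_le_of_grid
        (f := fun θ => ∑ j, (Real.cos (θ * signDot (ω (l, j)) x)
          - cosProd ((1 / 2) ^ (l.1 + 1)) x θ)) (K := R * (2 * (n * m))) (b := R * e) ?_
        (by positivity) ?_ hM ?_ θ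
      · refine hgrid.trans ?_
        rw [mul_assoc, ← mul_add]
        gcongr
        linarith
      · intro θ
        refine Finset.sum_congr rfl fun j _ => ?_
        have h1 := cos_mul_intCast_periodic (signDot (ω (l, j)) x) θ
        simp only at h1
        rw [h1, cosProd_periodic]
      · intro θ θ'
        rw [← Finset.sum_sub_distrib]
        refine (Finset.abs_sum_le_sum_abs _ _).trans ?_
        calc _ ≤ ∑ _j : Fin R, 2 * (|θ - θ'| * (n * m)) := by
              refine Finset.sum_le_sum fun j _ => ?_
              rw [sub_sub_sub_comm]
              refine (abs_sub _ _).trans ?_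
              have h1 := abs_cos_signDot_sub_le (ω (l, j)) hx θ θ'
              have h2 := _root_.abs_cosProd_sub_le (r := (1 / 2) ^ (l.1 + 1)) (by positivity)
                (half_pow_le_one _) hx θ θ'
              linarith
          _ = _ := by simp; ring
      · intro g
        have h1 := hne (l, g)
        simp only [hE, hZ, Finset.sum_product, Finset.sum_singleton, Finset.card_product,
          Finset.card_singleton, Finset.card_univ, Fintype.card_fin, one_mul, not_le] at h1
        exact h1.le
  calc _ ≤ ∑ ω, ∑ q, if E q ω then ∏ i, rowWeight ((1 / 2) ^ (i.1.1 + 1)) (ω i) else 0 := by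
        rw [Finset.sum_filter]
        refine Finset.sum_le_sum fun ω _ => ?_
        have hn : 0 ≤ ∏ i, rowWeight ((1 / 2) ^ (i.1.1 + 1)) (ω i) :=
          Finset.prod_nonneg fun i _ => hw0 _ _
        have hn' : ∀ q, 0 ≤ if E q ω then ∏ i, rowWeight ((1 / 2) ^ (i.1.1 + 1)) (ω i) else 0 :=
          fun q => by split_ifs; exacts [hn, le_rfl]
        split_ifs with hω
        · exact Finset.sum_nonneg fun q _ => hn' q
        · obtain ⟨q, hq⟩ := hcover ω hω
          refine le_trans ?_ (Finset.single_le_sum (fun q _ => hn' q) (Finset.mem_univ q))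
          rw [if_pos hq]
    _ = ∑ q, ∑ ω with E q ω, ∏ i, rowWeight ((1 / 2) ^ (i.1.1 + 1)) (ω i) := by
        rw [Finset.sum_comm]
        simp only [Finset.sum_filter]
    _ ≤ ∑ _q : Fin L × Fin M, 2 * Real.exp (-(R * e ^ 2 / 16)) :=
        Finset.sum_le_sum fun q _ => hprob q
    _ = _ := by simp

/-- A short list of seeds for which the sketches of most seeds agree with the input. -/
theorem exists_seeded_rows {L R M m s Q : ℕ} (hM : 0 < M) {e : ℝ} (he : 0 < e) (he4 : e ≤ 4)
    (hMe : 2 * (n * m) * (2 * Real.pi / M) ≤ e)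
    (hR : L * M * (2 * Real.exp (-(R * e ^ 2 / 16))) ≤ (1 / 2) ^ Q)
    (hs : (2 * m + 1) ^ n < 2 ^ 2 ^ s) :
    ∃ f : (Fin s → Bool) → Fin L × Fin R → Fin n → SignType, ∀ x : Fin n → ℤ,
      (∀ i, |x i| ≤ (m : ℤ)) →
      Q * Set.ncard {b | ¬ Agrees (fun l j => signDot (f b (l, j)) x) x (2 * e)} ≤ 2 * 2 ^ s := by
  classical
  obtain ⟨f, hf⟩ := exists_forall_mul_card_le (κ := Fin s → Bool)
    (X := Fin n → Finset.Icc (-(m : ℤ)) m)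
    (w := fun ω : Fin L × Fin R → Fin n → SignType =>
      ∏ i, rowWeight ((1 / 2) ^ (i.1.1 + 1)) (ω i))
    (fun ω => Finset.prod_nonneg fun i _ =>
      rowWeight_nonneg (by positivity) (half_pow_le_one _) _)
    (by
      rw [sum_pi_prod fun (i : Fin L × Fin R) (a : Fin n → SignType) =>
        rowWeight ((1 / 2) ^ (i.1.1 + 1)) a]
      simp [sum_rowWeight])
    (fun x ω => ¬ Agrees (fun l j => signDot (ω (l, j)) fun i => (x i : ℤ)) (fun i => (x i : ℤ))
      (2 * e)) Q
    (fun x => (sum_not_agrees_le hM he he4 hMe fun i =>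
      abs_le.2 (Finset.mem_Icc.1 (x i).2)).trans hR)
    (by
      simp only [Fintype.card_pi, Finset.prod_const, Finset.card_univ, Fintype.card_fin,
        Fintype.card_coe, Int.card_Icc, Fintype.card_bool]
      rwa [show ((m : ℤ) + 1 - -m).toNat = 2 * m + 1 by omega])
  refine ⟨f, fun x hx => ?_⟩
  have h := hf fun i => ⟨x i, Finset.mem_Icc.2 (abs_le.1 (hx i))⟩
  rw [Set.ncard_eq_toFinset_card', Set.toFinset_ofPred]
  simpa using h

end SignRows

/-! ### The sketch and its estimator -/

section Sketch

variable {n : ℕ}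

open Classical in
/-- The sketch with the rows `f`. Its estimate is the value of `F` at any admissible vector that
agrees with what is stored. -/
noncomputable def signSketch {L R s : ℕ} (f : (Fin s → Bool) → Fin L × Fin R → Fin n → SignType)
    (W : ℕ) (adm : (Fin n → ℤ) → Prop) (e : ℝ) (F : (Fin n → ℤ) → ℝ) : LinearSketch n where
  seedLen := s
  rows := L * R
  wordLen := W
  mat b := Matrix.of fun j i => (f b (finProdFinEquiv.symm j) i : ℤ)
  -- The seed is not needed here, because agreement compares the stored values with expectations
  -- over the rows and not with the rows themselves. The default 0 is never used if an admissible
  -- input agrees with its own sketch.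
  estimate _ v :=
    if h : ∃ y, adm y ∧ Agrees (fun l j => v (finProdFinEquiv (l, j))) y e then F h.choose else 0

theorem signSketch_mulVec {L R s : ℕ} (f : (Fin s → Bool) → Fin L × Fin R → Fin n → SignType)
    (W : ℕ) (adm : (Fin n → ℤ) → Prop) (e : ℝ) (F : (Fin n → ℤ) → ℝ) (b : Fin s → Bool)
    (x : Fin n → ℤ) (j : Fin (L * R)) :
    ((signSketch f W adm e F).mat b *ᵥ x) j = signDot (f b (finProdFinEquiv.symm j)) x := rfl

theorem signSketch_output {L R s : ℕ} (f : (Fin s → Bool) → Fin L × Fin R → Fin n → SignType)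
    (W : ℕ) {adm : (Fin n → ℤ) → Prop} {e : ℝ} (F : (Fin n → ℤ) → ℝ) {b : Fin s → Bool}
    {x : Fin n → ℤ} (hx : adm x) (hb : Agrees (fun l j => signDot (f b (l, j)) x) x e) :
    ∃ y, adm y ∧ Agrees (fun l j => signDot (f b (l, j)) x) y e ∧
      (signSketch f W adm e F).output b x = F y := by
  have hv : (fun (l : Fin L) (j : Fin R) =>
      ((signSketch f W adm e F).mat b *ᵥ x) (finProdFinEquiv (l, j)))
      = fun l j => signDot (f b (l, j)) x := by
    funext l j
    rw [signSketch_mulVec, Equiv.symm_apply_apply]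
  have hex : ∃ y, adm y ∧ Agrees (fun (l : Fin L) (j : Fin R) =>
      ((signSketch f W adm e F).mat b *ᵥ x) (finProdFinEquiv (l, j))) y e := by
    rw [hv]; exact ⟨x, hx, hb⟩
  refine ⟨hex.choose, hex.choose_spec.1, ?_, dif_pos hex⟩
  have := hex.choose_spec.2
  generalize hex.choose = y at this ⊢
  rwa [hv] at this

/-- A sketch of sign rows estimates every quantity that is determined up to a factor `1 ± ε` by
the expected cosines. -/
theorem exists_linearSketch {L R M m s Q W : ℕ} (hRpos : 0 < R) (hQ : 0 < Q) (hM : 0 < M) {e : ℝ}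
    (he : 0 < e) (he4 : e ≤ 4) (hMe : 2 * (n * m) * (2 * Real.pi / M) ≤ e)
    (hR : L * M * (2 * Real.exp (-(R * e ^ 2 / 16))) ≤ (1 / 2) ^ Q)
    (hs : (2 * m + 1) ^ n < 2 ^ 2 ^ s) (hW : n * m < 2 ^ W) {ε : ℝ} (adm : (Fin n → ℤ) → Prop)
    (F : (Fin n → ℤ) → ℝ)
    (hF : ∀ x y, adm x → adm y → (∀ l < L, ∀ θ,
      |cosProd ((1 / 2) ^ (l + 1)) y θ - cosProd ((1 / 2) ^ (l + 1)) x θ| ≤ 4 * e) →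
      (1 - ε) * F x ≤ F y ∧ F y ≤ (1 + ε) * F x) :
    ∃ S : LinearSketch n, S.bits = s + L * R * (W + 1) ∧ S.Fits m ∧
      ∀ x : Fin n → ℤ, (∀ i, |x i| ≤ (m : ℤ)) → adm x → 1 - 2 / Q ≤ S.successProb x (F x) ε := by
  obtain ⟨f, hf⟩ := exists_seeded_rows (n := n) hM he he4 hMe hR hs
  refine ⟨signSketch f W adm (2 * e) F, rfl, fun b x hx j => ?_, fun x hx hadm => ?_⟩
  · refine (abs_signDot_le (f b (finProdFinEquiv.symm j)) hx).trans_lt ?_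
    change ((n * m : ℕ) : ℤ) < 2 ^ W
    exact_mod_cast hW
  · set bad := {b | ¬ Agrees (fun l j => signDot (f b (l, j)) x) x (2 * e)} with hbad
    have hsub : badᶜ ⊆ {b : Fin s → Bool |
        (1 - ε) * F x ≤ (signSketch f W adm (2 * e) F).output b x ∧
        (signSketch f W adm (2 * e) F).output b x ≤ (1 + ε) * F x} := fun b hb => by
      have hb' : Agrees (fun l j => signDot (f b (l, j)) x) x (2 * e) := by
        by_contra hc
        exact hb hc
      obtain ⟨y, hy, hag, hout⟩ := signSketch_output f W F hadm hb'
      rw [Set.mem_ofPred_eq, hout]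
      refine hF x y hadm hy fun l hl θ => ?_
      -- The input and the vector found by the estimator agree with the same data up to 2e each.
      refine (hb'.abs_cosProd_sub_le hRpos hag hl θ).trans_eq ?_
      ring
    have hcard := Set.ncard_le_ncard hsub
    have hcompl : bad.ncard + badᶜ.ncard = 2 ^ s := by
      rw [Set.ncard_add_ncard_compl]
      simp
    have hQbad := hf x hx
    rw [← hbad] at hQbad
    have hQ' : (0 : ℝ) < Q := by exact_mod_cast hQ
    have h1 : (bad.ncard : ℝ) + badᶜ.ncard = 2 ^ s := by exact_mod_cast hcompl
    have h2 : (Q : ℝ) * bad.ncard ≤ 2 * 2 ^ s := by exact_mod_cast hQbad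
    have h3 : (bad.ncard : ℝ) ≤ 2 / Q * 2 ^ s := by
      rw [div_mul_eq_mul_div, le_div_iff₀ hQ']; linarith
    have h4 : (badᶜ.ncard : ℝ) ≤ Set.ncard {b : Fin s → Bool |
        (1 - ε) * F x ≤ (signSketch f W adm (2 * e) F).output b x ∧
        (signSketch f W adm (2 * e) F).output b x ≤ (1 + ε) * F x} := by exact_mod_cast hcard
    change 1 - 2 / (Q : ℝ) ≤ (Set.ncard {b : Fin s → Bool |
        (1 - ε) * F x ≤ (signSketch f W adm (2 * e) F).output b x ∧
        (signSketch f W adm (2 * e) F).output b x ≤ (1 + ε) * F x} : ℝ) / 2 ^ s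
    rw [le_div_iff₀ (by positivity)]
    linarith

end Sketch

/-! ### Choice of the parameters -/

/-- The property of the constant `C` in `exists_abs_sum_smoothStep_sub_le`. -/
def StepConstant (C : ℝ) : Prop :=
  1 ≤ C ∧ ∀ (J n : ℕ) (x y : Fin n → ℤ) (ε₁ ε₀ : ℝ),
    (∀ θ, |cosDefect y θ - cosDefect x θ| ≤ ε₁ * cosDefect x θ + ε₀) →
    0 ≤ ε₁ → 0 ≤ ε₀ → ∀ t : ℝ,
    |∑ i, smoothStep J (y i / t) - ∑ i, smoothStep J (x i / t)|
      ≤ C * (J + 1) ^ 3 * (ε₁ * ∑ i, min 1 ((x i / t : ℝ) ^ 2) + ε₀)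

/-- The factor by which the smooth steps overestimate is small. -/
theorem overestimate_le {ε P j : ℝ} (hε : 0 < ε) (hε1 : ε ≤ 1) (hP : 1 ≤ P) (hj : 1 ≤ j)
    (h : 100 * P ≤ ε * j) : (1 + 1 / j) ^ 2 * (1 + ((1 + 1 / j) ^ 2 - 1) * P) ≤ 1 + ε / 8 := by
  have hj0 : 0 < j := by linarith
  set b := 1 / j with hb
  have hb0 : 0 < b := by positivity
  have hb1 : b ≤ 1 := by rw [hb, div_le_one hj0]; exact hj
  have hbP : 100 * (b * P) ≤ ε := by
    have : b * (100 * P) ≤ b * (ε * j) := by gcongr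
    have h2 : b * (ε * j) = ε := by rw [hb]; field_simp
    linarith
  have hbε : b ≤ b * P := le_mul_of_one_le_right hb0.le hP
  have h1 : (1 + b) ^ 2 - 1 ≤ 3 * b := by nlinarith
  have h2 : ((1 + b) ^ 2 - 1) * P ≤ 3 * (b * P) := by
    rw [← mul_assoc]; gcongr
  have h3 : (1 + b) ^ 2 ≤ 1 + 3 * (b * P) := by linarith
  have h4 : 0 ≤ (1 + b) ^ 2 - 1 := by nlinarith
  calc _ ≤ (1 + 3 * (b * P)) * (1 + 3 * (b * P)) := by
        refine mul_le_mul h3 (by linarith) ?_ (by linarith)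
        linarith [mul_nonneg h4 (by linarith : 0 ≤ P)]
    _ ≤ _ := by nlinarith [mul_nonneg hb0.le (by linarith : 0 ≤ P)]

/-- The additive error of the counts leaves a small multiple of the unknown moment v on the right,
which is absorbed on the left. -/
theorem le_of_le_add_mul {ε u v a b c : ℝ} (hε : 0 < ε) (hε1 : ε ≤ 1) (hu : 0 ≤ u) (hv : 0 ≤ v)
    (ha : a ≤ 1 + ε / 8) (hb : b ≤ ε / 16) (hc : c ≤ ε / 16) (h : v ≤ (a + b) * u + c * v) :
    v ≤ (1 + ε / 2) * u := by
  have h1 : v ≤ (1 + ε / 8 + ε / 16) * u + ε / 16 * v := h.trans (by gcongr)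
  have h2 : (1 - ε / 16) * v ≤ (1 - ε / 16) * ((1 + ε / 2) * u) := by
    have h3 : (1 + ε / 8 + ε / 16) ≤ (1 - ε / 16) * (1 + ε / 2) := by nlinarith
    calc _ ≤ (1 + ε / 8 + ε / 16) * u := by linarith
      _ ≤ (1 - ε / 16) * (1 + ε / 2) * u := by gcongr
      _ = _ := by ring
  exact le_of_mul_le_mul_left h2 (by linarith)

/-- If the expected cosines of two vectors are close, and the tail of one of them is bounded, the
top moment of the other is not much larger. -/
theorem topMoment_le_of_cosProd_close {C : ℝ} (hC : StepConstant C) {n k d N q m E L : ℕ}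
    (hk : 1 ≤ k) (hkn : k ≤ n) (hN : 1 ≤ N) (hm : Real.log m ≤ d * N) {ε p : ℝ} (hε : 1 ≤ ε * N)
    (hε0 : 0 < ε) (hε1 : ε ≤ 1) (hp : 0 ≤ p) (hp2 : p ≤ 2)
    (hE : 64 * (C * (101 * N ^ (q + 1)) ^ 3 * N ^ q * (1 + d) * N ^ 2) ≤ E)
    (hL : (8 : ℝ) * n * E ≤ 2 ^ (L + 1)) {x y : Fin n → ℤ}
    (hy : ∀ i, |y i| ≤ (m : ℤ)) (hx : tailNormSq x k ≤ N ^ q * k * rankedCoord x k ^ 2)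
    (hclose : ∀ l < L + 1, ∀ θ, |cosProd ((1 / 2) ^ (l + 1)) y θ
      - cosProd ((1 / 2) ^ (l + 1)) x θ| ≤ 1 / (32 * E ^ 2)) :
    topMoment y k p ≤ (1 + ε / 2) * topMoment x k p := by
  obtain ⟨hC1, hC⟩ := hC
  have hN' : (1 : ℝ) ≤ N := by exact_mod_cast hN
  set P : ℝ := (N : ℝ) ^ q with hP
  have hP1 : 1 ≤ P := one_le_pow₀ hN'
  set D' : ℝ := C * (101 * N ^ (q + 1)) ^ 3 with hD'
  have hNq : (1 : ℝ) ≤ (N : ℝ) ^ (q + 1) := one_le_pow₀ hN'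
  have hD'1 : 1 ≤ D' := one_le_mul_of_one_le_of_one_le hC1 (one_le_pow₀ (by linarith))
  have hd : (0 : ℝ) ≤ d := d.cast_nonneg
  have hE1 : (1 : ℝ) ≤ E := by
    refine le_trans ?_ hE
    have : 1 ≤ D' * P * (1 + d) * N ^ 2 :=
      one_le_mul_of_one_le_of_one_le (one_le_mul_of_one_le_of_one_le
        (one_le_mul_of_one_le_of_one_le hD'1 hP1) (by linarith)) (one_le_pow₀ hN')
    linarith
  have hE0 : (0 : ℝ) < E := by linarith
  obtain ⟨s, hs⟩ := exists_hasThreshold hk hkn hx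
  -- One factor N pays for 1/ε and N^q for the tail constant P, so that 100 P ≤ εJ.
  set J : ℕ := 100 * N ^ (q + 1) with hJ
  have hJ1 : 1 ≤ J := by have := Nat.one_le_pow (q + 1) N hN; omega
  have hJr : (J : ℝ) = 100 * (N * P) := by rw [hJ, hP]; push_cast; ring
  have hdef : ∀ θ, |cosDefect y θ - cosDefect x θ|
      ≤ 1 / E * cosDefect x θ + 4 * (1 / (32 * E ^ 2)) := fun θ => by
    -- With ε₁ = 1/E, the tolerance 1/(32E²) is the largest allowed by 32ε₂ ≤ ε₁².
    refine abs_cosDefect_sub_le (L := L) (by positivity) ?_ (by positivity) ?_ ?_ fun l hl =>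
      hclose l hl θ
    · rw [div_le_one hE0]; exact hE1
    · rw [div_pow, one_pow]
      field_simp
      exact le_rfl
    · rw [one_div_mul_eq_div, le_div_iff₀ hE0]
      exact hL
  have hclose' := hC J n x y (1 / E) (4 * (1 / (32 * E ^ 2))) hdef (by positivity) (by positivity)
  have hmain := hs.topMoment_le hk hkn hp hp2 (by positivity) hJ1 hy
    (mul_nonneg (by linarith) (by positivity)) (by positivity) (by positivity) hclose'
  have hover := overestimate_le hε0 hε1 hP1 (j := J) (by exact_mod_cast hJ1) (by
    rw [hJr]; nlinarith)
  have hD : C * ((J : ℝ) + 1) ^ 3 ≤ D' := by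
    rw [hD', hJ]
    push_cast
    gcongr
    linarith
  set D : ℝ := C * ((J : ℝ) + 1) ^ 3 with hDdef
  have hD0 : 0 ≤ D := mul_nonneg (by linarith) (by positivity)
  have hDE : 64 * (D * (P * (1 + d) * N)) ≤ ε * E := by
    have h1 : D * (P * (1 + d) * N) ≤ D' * (P * (1 + d) * N) := by gcongr
    have h2 : 64 * (D' * (P * (1 + d) * N)) * N ≤ ε * E * N := by
      calc _ = 64 * (D' * P * (1 + d) * N ^ 2) := by ring
        _ ≤ 1 * E := by rw [one_mul]; exact hE
        _ ≤ ε * N * E := by gcongr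
        _ = _ := by ring
    have h3 := le_of_mul_le_mul_right h2 (by linarith)
    linarith
  have hterm1 : D * (1 / E) * (2 * (1 + P) * (1 + Real.log m)) ≤ ε / 16 := by
    have h1 : 2 * (1 + P) * (1 + Real.log m) ≤ 4 * (P * (1 + d) * N) := by
      have hlog : 1 + Real.log m ≤ (1 + d) * N := by linarith
      have h0 : 0 ≤ (1 + (d : ℝ)) * N := by positivity
      calc _ ≤ 2 * (P + P) * ((1 + d) * N) := by gcongr
        _ = _ := by ring
    calc _ ≤ D * (1 / E) * (4 * (P * (1 + d) * N)) := by gcongr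
      _ = (64 * (D * (P * (1 + d) * N))) / (16 * E) := by field_simp; ring
      _ ≤ ε * E / (16 * E) := by gcongr
      _ = _ := by field_simp
  have hterm2 : D * (4 * (1 / (32 * E ^ 2))) ≤ ε / 16 := by
    have h1 : D ≤ D * (P * (1 + d) * N) := le_mul_of_one_le_right hD0
      (one_le_mul_of_one_le_of_one_le (one_le_mul_of_one_le_of_one_le hP1 (by linarith)) hN')
    have h2 : D ≤ ε * E := by linarith
    have h3 : (E : ℝ) ≤ E ^ 2 := le_self_pow₀ hE1 (by norm_num)
    rw [mul_one_div, mul_div_assoc', div_le_div_iff₀ (by positivity) (by positivity)]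
    have h4 := mul_le_mul_of_nonneg_left h3 hε0.le
    linarith
  exact le_of_le_add_mul hε0 hε1 (topMoment_nonneg x k p) (topMoment_nonneg y k p) hover hterm1
    hterm2 hmain

/-- The sketch with its parameters, in terms of integers `N` and `E`. -/
theorem exists_linearSketch_topMoment {C : ℝ} (hC : StepConstant C) {n k d N q E Q : ℕ}
    (hn : 1 ≤ n) (hkn : k ≤ n) (hN : 1 ≤ N) (hnN : n ≤ 2 ^ N) (hlog : Real.log n ≤ N) {ε p : ℝ}
    (hε : 1 ≤ ε * N) (hε0 : 0 < ε) (hε1 : ε ≤ 1) (hp : 0 ≤ p) (hp2 : p ≤ 2) (hQ : 0 < Q)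
    (hE1 : 1 ≤ E) (hE : 64 * (C * (101 * N ^ (q + 1)) ^ 3 * N ^ q * (1 + d) * N ^ 2) ≤ E) :
    ∃ S : LinearSketch n, S.Fits (n ^ d) ∧
      S.bits = ((d + 1) * N + 2) + (N + E + 3) * (2 ^ 18 * E ^ 4 *
        ((N + E + 3) + (N * (d + 1) + 11 + 2 * E) + 1 + Q)) * (N * (d + 1) + 1 + 1) ∧
      ∀ x : Fin n → ℤ, (∀ i, |x i| ≤ ((n ^ d : ℕ) : ℤ)) →
        (1 ≤ k → tailNormSq x k ≤ N ^ q * k * rankedCoord x k ^ 2) →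
        1 - 2 / Q ≤ S.successProb x (topMoment x k p) ε := by
  have hE' : (1 : ℝ) ≤ E := by exact_mod_cast hE1
  have hE0 : (0 : ℝ) < E := by linarith
  have hE2 : E ≤ 2 ^ E := Nat.lt_two_pow_self.le
  have hnd : n * n ^ d ≤ 2 ^ (N * (d + 1)) := by
    rw [← pow_succ', pow_mul]
    exact Nat.pow_le_pow_left hnN _
  -- A grid of 2^a frequencies is fine enough: 2^(N(d+1)) covers nm, 2^11 covers 512π and 2^(2E)
  -- covers E². With Y below, the number of rows per rate makes R e²/16 equal to Y, and 2^(-Y) pays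
  -- for the union bound over rates and frequencies with 2^(-Q) to spare.
  set a := N * (d + 1) + 11 + 2 * E with ha
  set Y := (N + E + 3) + a + 1 + Q with hY
  set e : ℝ := 1 / (128 * E ^ 2) with he
  have he0 : 0 < e := by positivity
  obtain ⟨S, hbits, hfits, hS⟩ := exists_linearSketch (n := n) (L := N + E + 3)
    (R := 2 ^ 18 * E ^ 4 * Y) (M := 2 ^ a) (m := n ^ d) (s := (d + 1) * N + 2) (Q := Q)
    (W := N * (d + 1) + 1) (by positivity) hQ (by positivity) he0
    (by
      rw [he, div_le_iff₀ (by positivity)]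
      nlinarith)
    (by
      have hpi := Real.pi_lt_d2
      have h1 : ((n : ℝ) * (n ^ d : ℕ)) ≤ 2 ^ (N * (d + 1)) := by exact_mod_cast hnd
      have h2 : (E : ℝ) ^ 2 ≤ 2 ^ (2 * E) := by
        rw [mul_comm, pow_mul]
        gcongr
        exact_mod_cast hE2
      rw [he, mul_div_assoc', div_le_div_iff₀ (by positivity) (by positivity)]
      calc _ = (n * (n ^ d : ℕ)) * (512 * Real.pi) * (E : ℝ) ^ 2 := by ring
        _ ≤ 2 ^ (N * (d + 1)) * 2 ^ 11 * 2 ^ (2 * E) := by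
            gcongr
            linarith
        _ = _ := by rw [ha, pow_add, pow_add]; push_cast; ring)
    (by
      have hY2 : ((2 ^ 18 * E ^ 4 * Y : ℕ) : ℝ) * e ^ 2 / 16 = Y := by
        rw [he]
        push_cast
        field_simp
        ring
      have hexp : Real.exp (-(Y : ℝ)) ≤ (1 / 2) ^ Y := by
        rw [Real.exp_neg, one_div_pow, ← one_div]
        refine one_div_le_one_div_of_le (by positivity) ?_
        rw [← mul_one (Y : ℝ), Real.exp_nat_mul]
        gcongr
        have := Real.add_one_le_exp (1 : ℝ)
        linarith
      have hlev : ((N + E + 3 : ℕ) : ℝ) ≤ 2 ^ (N + E + 3) := by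
        exact_mod_cast Nat.lt_two_pow_self.le
      rw [hY2]
      calc _ ≤ (2 : ℝ) ^ (N + E + 3) * (2 ^ a : ℕ) * (2 * (1 / 2) ^ Y) := by gcongr
        _ = (2 * (1 / 2)) ^ (N + E + 3 + a + 1) * (1 / 2) ^ Q := by
            rw [hY, mul_pow, pow_add _ _ Q]; push_cast; ring
        _ = _ := by norm_num)
    (by
      calc (2 * n ^ d + 1) ^ n < (2 ^ (2 * n ^ d + 1)) ^ n :=
            Nat.pow_lt_pow_left Nat.lt_two_pow_self (by omega)
        _ = 2 ^ ((2 * n ^ d + 1) * n) := (pow_mul _ _ _).symm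
        _ ≤ _ := by
            refine Nat.pow_le_pow_right (by norm_num) ?_
            have h1 : 1 ≤ n ^ d := Nat.one_le_pow _ _ hn
            rw [pow_add, mul_comm (d + 1)]
            nlinarith)
    (by
      rw [pow_succ]
      have : 0 < 2 ^ (N * (d + 1)) := by positivity
      omega)
    (ε := ε)
    (fun x => (∀ i, |x i| ≤ ((n ^ d : ℕ) : ℤ)) ∧
      (1 ≤ k → tailNormSq x k ≤ N ^ q * k * rankedCoord x k ^ 2))
    (fun x => topMoment x k p)
    (by
      intro x y hx hy hxy
      have h4e : 4 * e = 1 / (32 * E ^ 2) := by rw [he]; field_simp; norm_num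
      rw [h4e] at hxy
      -- For k = 0 there is no promise, and both moments are empty sums.
      rcases Nat.eq_zero_or_pos k with hk | hk
      · simp [hk, topMoment]
      have hm : Real.log ((n ^ d : ℕ) : ℝ) ≤ d * N := by
        push_cast
        rw [Real.log_pow]
        gcongr
      have hL : (8 : ℝ) * n * E ≤ 2 ^ (N + E + 2 + 1) := by
        have h1 : (n : ℝ) ≤ 2 ^ N := by exact_mod_cast hnN
        have h2 : (E : ℝ) ≤ 2 ^ E := by exact_mod_cast hE2
        calc (8 : ℝ) * n * E ≤ 8 * 2 ^ N * 2 ^ E := by gcongr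
          _ = _ := by ring
      have h1 := topMoment_le_of_cosProd_close hC hk hkn hN hm hε hε0 hε1 hp hp2 hE hL hy.1
        (hx.2 hk) hxy
      have h2 := topMoment_le_of_cosProd_close hC hk hkn hN hm hε hε0 hε1 hp hp2 hE hL hx.1
        (hy.2 hk) fun l hl θ => by rw [abs_sub_comm]; exact hxy l hl θ
      have hFx := topMoment_nonneg x k p
      have hFy := topMoment_nonneg y k p
      constructor
      · have h3 : (1 - ε) * topMoment x k p ≤ (1 - ε) * ((1 + ε / 2) * topMoment y k p) :=
          mul_le_mul_of_nonneg_left h2 (by linarith)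
        nlinarith [mul_nonneg hε0.le hFy, mul_nonneg (mul_nonneg hε0.le hε0.le) hFy]
      · nlinarith [mul_nonneg hε0.le hFx])
  refine ⟨S, hfits, ?_, fun x hx hx2 => hS x hx ⟨hx, hx2⟩⟩
  rw [hbits]

/-- The seventh power consists of E for the rates, E^5 for the rows per rate and E for the word
length. -/
theorem bits_le {d N E Q : ℕ} (hN : 1 ≤ N) (hE : N ≤ E) :
    ((d + 1) * N + 2) + (N + E + 3) * (2 ^ 18 * E ^ 4 *
      ((N + E + 3) + (N * (d + 1) + 11 + 2 * E) + 1 + Q)) * (N * (d + 1) + 1 + 1)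
      ≤ ((d + 3) + 5 * 2 ^ 18 * (20 + d + Q) * (d + 3)) * E ^ 7 := by
  have hE1 : 1 ≤ E := hN.trans hE
  have hdN : N * (d + 1) ≤ E * (d + 1) := Nat.mul_le_mul_right _ hE
  have h1 : (d + 1) * N + 2 ≤ (d + 3) * E := by nlinarith
  have h2 : N + E + 3 ≤ 5 * E := by omega
  have h3 : (N + E + 3) + (N * (d + 1) + 11 + 2 * E) + 1 + Q ≤ (20 + d + Q) * E := by nlinarith
  have h4 : N * (d + 1) + 1 + 1 ≤ (d + 3) * E := by nlinarith
  have h5 : E ≤ E ^ 7 := Nat.le_self_pow (by norm_num) E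
  calc _ ≤ (d + 3) * E + (5 * E) * (2 ^ 18 * E ^ 4 * ((20 + d + Q) * E)) * ((d + 3) * E) := by
        gcongr
    _ = (d + 3) * E + 5 * 2 ^ 18 * (20 + d + Q) * (d + 3) * E ^ 7 := by ring
    _ ≤ (d + 3) * E ^ 7 + 5 * 2 ^ 18 * (20 + d + Q) * (d + 3) * E ^ 7 := by gcongr
    _ = _ := by ring

theorem theorem1 (c : ℝ) :
    ∃ B : ℝ, 0 < B ∧ ∀ (d : ℕ) (δ : ℝ), 0 < δ → δ < 1 → ∃ A : ℝ, 0 < A ∧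
      ∀ (n : ℕ), 2 ≤ n → ∀ (k : ℕ), k ≤ n → ∀ (p : ℝ), 0 ≤ p → p ≤ 2 →
      ∀ (ε : ℝ), 0 < ε → ε < 1 →
        ∃ S : LinearSketch n,
          S.Fits (n ^ d) ∧
          (S.bits : ℝ) ≤ A * (Real.logb 2 n / ε) ^ B ∧
          ∀ x : Fin n → ℤ, (∀ i, |x i| ≤ ((n ^ d : ℕ) : ℤ)) →
            rankedCoord x k ^ 2 ≥ (ε / Real.logb 2 n) ^ c * (tailNormSq x k / k) →
              1 - δ ≤ S.successProb x (topMoment x k p) ε := by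
  obtain ⟨C, hC⟩ : ∃ C, StepConstant C := exists_abs_sum_smoothStep_sub_le
  have hC1 := hC.1
  -- For negative c this is 0, which is enough because log n / ε ≥ 1.
  set q := ⌈c⌉₊ with hq
  refine ⟨((7 * (4 * q + 5) : ℕ) : ℝ), by positivity, fun d δ hδ _ => ?_⟩
  set Q := ⌈2 / δ⌉₊ with hQ
  have hQ0 : 0 < Q := Nat.ceil_pos.2 (by positivity)
  have hQδ : 2 / (Q : ℝ) ≤ δ := by
    have h := Nat.le_ceil (2 / δ)
    rw [div_le_iff₀ hδ] at h
    rw [div_le_iff₀ (by exact_mod_cast hQ0), mul_comm]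
    exact h
  set K : ℕ := ⌈C⌉₊ * (64 * 101 ^ 3 * (1 + d)) with hK
  have hCK : C ≤ ⌈C⌉₊ := Nat.le_ceil C
  have hK1 : 1 ≤ K := by
    have : 1 ≤ ⌈C⌉₊ := by exact_mod_cast hC1.trans hCK
    exact Nat.one_le_iff_ne_zero.2 (by positivity)
  set G : ℕ := (d + 3) + 5 * 2 ^ 18 * (20 + d + Q) * (d + 3) with hG
  refine ⟨G * K ^ 7 * 2 ^ (7 * (4 * q + 5)), by positivity, ?_⟩
  intro n hn k hkn p hp hp2 ε hε0 hε1
  set Λ : ℝ := Real.logb 2 n / ε with hΛ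
  have hn2 : (2 : ℝ) ≤ n := by exact_mod_cast hn
  have hlog1 : 1 ≤ Real.logb 2 n := by
    rw [Real.le_logb_iff_rpow_le (by norm_num) (by linarith), Real.rpow_one]
    exact hn2
  have hlogΛ : Real.logb 2 n ≤ Λ := by
    rw [hΛ, le_div_iff₀ hε0]
    nlinarith
  have hΛ1 : 1 ≤ Λ := hlog1.trans hlogΛ
  set N := ⌈Λ⌉₊ with hNdef
  have hΛN : Λ ≤ N := Nat.le_ceil _
  have hNΛ : (N : ℝ) ≤ 2 * Λ := by
    have := Nat.ceil_lt_add_one (show 0 ≤ Λ by linarith)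
    linarith
  have hN1 : 1 ≤ N := by exact_mod_cast hΛ1.trans hΛN
  have hnN : n ≤ 2 ^ N := by
    have h : (n : ℝ) ≤ 2 ^ (N : ℝ) := by
      rw [← Real.logb_le_iff_le_rpow (by norm_num) (by linarith)]
      exact hlogΛ.trans hΛN
    rw [Real.rpow_natCast] at h
    exact_mod_cast h
  have hlogN : Real.log n ≤ N := by
    have h2 : Real.log 2 ≤ 1 := by linarith [Real.log_two_lt_d9]
    have h3 : Real.log n = Real.logb 2 n * Real.log 2 := by
      rw [Real.logb, div_mul_cancel₀ _ (by positivity)]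
    rw [h3]
    nlinarith
  have hεN : 1 ≤ ε * N := by
    have : ε * Λ = Real.logb 2 n := by rw [hΛ]; field_simp
    nlinarith
  -- The exponent is 3(q + 1) from the cube of J + 1, q from the tail constant, and 2 from the
  -- logarithm of the coordinate bound and from 1/ε.
  set E : ℕ := K * N ^ (4 * q + 5) with hE
  have hNE : N ≤ E :=
    (Nat.le_self_pow (by omega) N).trans (Nat.le_mul_of_pos_left _ hK1)
  obtain ⟨S, hfits, hbits, hS⟩ := exists_linearSketch_topMoment hC (d := d) (q := q) (E := E)
    (Q := Q) (by omega : 1 ≤ n) hkn hN1 hnN hlogN hεN hε0 hε1.le hp hp2 hQ0 (hN1.trans hNE) (by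
      rw [hE, hK, Nat.cast_mul, Nat.cast_mul, Nat.cast_pow, Nat.cast_mul, Nat.cast_add,
        Nat.cast_mul, Nat.cast_pow, Nat.cast_one, Nat.cast_ofNat, Nat.cast_ofNat]
      calc 64 * (C * (101 * (N : ℝ) ^ (q + 1)) ^ 3 * N ^ q * (1 + d) * N ^ 2)
          = C * (64 * 101 ^ 3 * (1 + d)) * N ^ (4 * q + 5) := by ring
        _ ≤ ⌈C⌉₊ * (64 * 101 ^ 3 * (1 + d)) * (N : ℝ) ^ (4 * q + 5) := by gcongr)
  refine ⟨S, hfits, ?_, fun x hx hprom => ?_⟩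
  · have h1 : S.bits ≤ G * E ^ 7 := hbits.le.trans (bits_le hN1 hNE)
    calc (S.bits : ℝ) ≤ G * E ^ 7 := by exact_mod_cast h1
      _ = G * K ^ 7 * N ^ (7 * (4 * q + 5)) := by rw [hE]; push_cast; ring
      _ ≤ G * K ^ 7 * (2 * Λ) ^ (7 * (4 * q + 5)) := by gcongr
      _ = _ := by rw [Real.rpow_natCast, mul_pow]; ring
  · refine le_trans (by linarith) (hS x hx fun hk => ?_)
    have hk0 : (0 : ℝ) < k := by exact_mod_cast hk
    have hinv : ε / Real.logb 2 n = Λ⁻¹ := by rw [hΛ, inv_div]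
    rw [hinv, Real.inv_rpow (by linarith), ge_iff_le, inv_mul_le_iff₀ (by positivity),
      div_le_iff₀ hk0] at hprom
    refine hprom.trans ?_
    have hpow : Λ ^ c ≤ (N : ℝ) ^ q := by
      calc Λ ^ c ≤ Λ ^ (q : ℝ) := Real.rpow_le_rpow_of_exponent_le hΛ1 (Nat.le_ceil c)
        _ = Λ ^ q := Real.rpow_natCast _ _
        _ ≤ _ := by gcongr
    calc _ = Λ ^ c * k * rankedCoord x k ^ 2 := by ring
      _ ≤ _ := by gcongr
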